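/- Let $n\in\mathbb N$. A holomorphic quadratic form $\varphi$ on $\mathbb C^n_x\times\mathbb C^n_y$ is called *admissible* if $\operatorname{Im}\varphi''_{yy}>0$ and $\det\varphi''_{xy}\neq 0$. For such a $\varphi$ and a constant $C_\varphi>0$, the associated metaplectic FBI–Bargmann transform of $u\in\mathscr S'(\mathbb R^n)$ is $$\mathcal T u(x)=C_\varphi\int_{\mathbb R^n} e^{i\varphi(x,y)}u(y)\,dy,\qquad x\in\mathbb C^n,$$ the integral being the pairing of $u$ with $e^{i\varphi(x,\cdot)}\in\mathscr S(\mathbb R^n)$, and the associated weight is $$\Phi(x)=\sup_{y\in\mathbb R^n}\bigl(-\operatorname{Im}\varphi(x,y)\bigr).$$ (The constant $C_\varphi$ is usually chosen so that $\mathcal T$ is unitary from $L^2(\mathbb R^n)$ onto $H^2_\Phi(\mathbb C^n)$; the statement holds for any positive constant.) For $1\le p\le\infty$ let $H^p_\Phi(\mathbb C^n)$ be the space of entire functions $v$ on $\mathbb C^n$ with $e^{-\Phi}v\in L^p(\mathbb C^n)$ with respect to Lebesgue measure, and put $\|v\|_{H^p_\Phi}=\|e^{-\Phi}v\|_{L^p}\in[0,\infty]$.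 **Proposition.** Let $\mathcal T,\widetilde{\mathcal T}$ be two metaplectic FBI–Bargmann transforms, with admissible forms $\varphi,\widetilde\varphi$, positive constants $C_\varphi,C_{\widetilde\varphi}$, and associated weights $\Phi,\widetilde\Phi$. 1. For every $1\le p\le\infty$ and every $u\in\mathscr S'(\mathbb R^n)$, we have $\mathcal T u\in H^p_\Phi(\mathbb C^n)$ if and only if $\widetilde{\mathcal T}u\in H^p_{\widetilde\Phi}(\mathbb C^n)$. 2. There is a constant $K>0$, depending only on $\mathcal T$ and $\widetilde{\mathcal T}$, such that for all $1\le p\le\infty$ and all $u\in\mathscr S'(\mathbb R^n)$, $$\|\widetilde{\mathcal T}u\|_{H^p_{\widetilde\Phi}}\le K\,\|\mathcal T u\|_{H^p_\Phi}\quad\text{and}\quad \|\mathcal T u\|_{H^p_\Phi}\le K\,\|\widetilde{\mathcal T}u\|_{H^p_{\widetilde\Phi}}.$$ 3. Consequently, for every $1\le p\le\infty$, the modulation space $M^p(\mathbb R^n)=\{u\in\mathscr S'(\mathbb R^n):\mathcal T u\in H^p_\Phi(\mathbb C^n)\}$ does not depend on the choice of the transform: $\mathcal T$ and $\widetilde{\mathcal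 T}$ define the same space. -/

import Mathlib

open MeasureTheory
open scoped SchwartzMap ENNReal NNReal ContDiff

namespace FBI

/-- The derivative of a function of temperate growth has temperate growth. -/
theorem temperate_fderiv {E F : Type} [NormedAddCommGroup E] [NormedSpace ℝ E]
    [NormedAddCommGroup F] [NormedSpace ℝ F] {f : E → F} (hf : f.HasTemperateGrowth) :
    (fderiv ℝ f).HasTemperateGrowth := by
  refine ⟨hf.1.fderiv_right (by simp), fun n => ?_⟩
  obtain ⟨k, C, h⟩ := hf.2 (n + 1)
  exact ⟨k, C, fun x => by simpa [norm_iteratedFDeriv_fderiv] using h x⟩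

/-- `e ^ P` is smooth, and decays with all its derivatives (here: after multiplication by an
arbitrary function of temperate growth) if `P` has temperate growth and `Re P` is bounded above by
a quadratic polynomial in the norm with negative leading coefficient. -/
theorem decay_cexp_smul {E : Type} [NormedAddCommGroup E] [NormedSpace ℝ E] {P : E → ℂ}
    (hP : P.HasTemperateGrowth) {A M c : ℝ} (hc : 0 < c)
    (hre : ∀ y, (P y).re ≤ A + M * ‖y‖ - c * ‖y‖ ^ 2) (m : ℕ) :
    ∀ {F : Type} [NormedAddCommGroup F] [NormedSpace ℂ F] (g : E → F),
      g.HasTemperateGrowth → ∀ k : ℕ, ∃ B : ℝ, ∀ y,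
        ‖y‖ ^ k * ‖iteratedFDeriv ℝ m (fun z => Complex.exp (P z) • g z) y‖ ≤ B := by
  induction m with
  | zero =>
    intro F _ _ g hg k
    obtain ⟨l, C, hC⟩ := hg.2 0
    have hC0 : 0 ≤ C := by
      have h0 := hC 0
      simp only [norm_zero, add_zero, one_pow, mul_one] at h0
      exact (norm_nonneg _).trans h0
    refine ⟨C * ((k + l).factorial * Real.exp (1 + A + (1 + M) ^ 2 / (4 * c))), fun y => ?_⟩
    have h1 : ‖g y‖ ≤ C * (1 + ‖y‖) ^ l := by simpa using hC y
    have hy : 0 ≤ ‖y‖ := norm_nonneg y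
    have h2 : (1 + ‖y‖) ^ (k + l) ≤ (k + l).factorial * Real.exp (1 + ‖y‖) := by
      have := Real.pow_div_factorial_le_exp (x := 1 + ‖y‖) (by positivity) (k + l)
      rw [div_le_iff₀ (by positivity)] at this
      linarith
    have h3 : Real.exp (1 + ‖y‖) * Real.exp (P y).re ≤
        Real.exp (1 + A + (1 + M) ^ 2 / (4 * c)) := by
      rw [← Real.exp_add]
      apply Real.exp_le_exp.2
      have h4 : (1 + M) * ‖y‖ - c * ‖y‖ ^ 2 ≤ (1 + M) ^ 2 / (4 * c) := by
        rw [le_div_iff₀ (by positivity)]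
        nlinarith [sq_nonneg (1 + M - 2 * c * ‖y‖)]
      linarith [hre y]
    rw [norm_iteratedFDeriv_zero, norm_smul, Complex.norm_exp]
    calc ‖y‖ ^ k * (Real.exp (P y).re * ‖g y‖)
        ≤ (1 + ‖y‖) ^ k * (Real.exp (P y).re * (C * (1 + ‖y‖) ^ l)) := by
          gcongr
          linarith
      _ = C * ((1 + ‖y‖) ^ (k + l) * Real.exp (P y).re) := by rw [pow_add]; ring
      _ ≤ C * (((k + l).factorial * Real.exp (1 + ‖y‖)) * Real.exp (P y).re) := by gcongr
      _ = C * ((k + l).factorial * (Real.exp (1 + ‖y‖) * Real.exp (P y).re)) := by ring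
      _ ≤ _ := by gcongr
  | succ m ih =>
    intro F _ _ g hg k
    have hPd : Differentiable ℝ P := hP.1.differentiable (by simp)
    have hgd : Differentiable ℝ g := hg.1.differentiable (by simp)
    let L : F →L[ℝ] (E →L[ℝ] ℂ) →L[ℝ] (E →L[ℝ] F) :=
      (ContinuousLinearMap.compL ℝ E ℂ F).comp (ContinuousLinearMap.lsmul ℝ ℂ).flip
    have hfd : fderiv ℝ (fun z => Complex.exp (P z) • g z) =
        fun z => Complex.exp (P z) • (fderiv ℝ g z + L (g z) (fderiv ℝ P z)) := by
      funext z
      have h1 : HasFDerivAt (fun z => Complex.exp (P z)) (Complex.exp (P z) • fderiv ℝ P z) z :=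
        (hPd z).hasFDerivAt.cexp
      refine (h1.smul (hgd z).hasFDerivAt).fderiv.trans ?_
      ext v
      simp [L, smul_smul]
    have hG : (fun z => fderiv ℝ g z + L (g z) (fderiv ℝ P z)).HasTemperateGrowth :=
      (temperate_fderiv hg).add (L.bilinear_hasTemperateGrowth hg (temperate_fderiv hP))
    obtain ⟨B, hB⟩ := ih _ hG k
    refine ⟨B, fun y => ?_⟩
    rw [← norm_iteratedFDeriv_fderiv, hfd]
    exact hB y

/-- A holomorphic quadratic form `φ` on `ℂⁿ × ℂⁿ` (variables `x` and `y`). -/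
abbrev HolQuadForm (n : ℕ) : Type := QuadraticForm ℂ ((Fin n → ℂ) × (Fin n → ℂ))

/-- The block `φ''_yy` of second derivatives of `φ` (the polar form `φ(v + w) - φ(v) - φ(w)` of a
quadratic form is its second differential). -/
def hessYY {n : ℕ} (φ : HolQuadForm n) : Matrix (Fin n) (Fin n) ℂ :=
  Matrix.of fun j k => QuadraticMap.polar φ (0, Pi.single j 1) (0, Pi.single k 1)

/-- The block `φ''_xy` of second derivatives of `φ`. -/
def hessXY {n : ℕ} (φ : HolQuadForm n) : Matrix (Fin n) (Fin n) ℂ :=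
  Matrix.of fun j k => QuadraticMap.polar φ (Pi.single j 1, 0) (0, Pi.single k 1)

/-- Admissible phases of metaplectic FBI-Bargmann transforms: holomorphic quadratic forms `φ` on
`ℂⁿ × ℂⁿ` with `Im φ''_yy > 0` and `det φ''_xy ≠ 0`. -/
structure Phase (n : ℕ) where
  /-- The quadratic form `φ`. -/
  form : HolQuadForm n
  im_hessYY_posDef : ((hessYY form).map Complex.im).PosDef
  det_hessXY_ne_zero : (hessXY form).det ≠ 0

/-- The inclusion `ℝⁿ ⊆ ℂⁿ`. -/
def ofRealVec {n : ℕ} (y : EuclideanSpace ℝ (Fin n)) : Fin n → ℂ := fun j => (y j : ℂ)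

/-- The expansion of `φ(x, y)` in powers of the coordinates of `y ∈ ℝⁿ`. -/
theorem form_expand {n : ℕ} (φ : HolQuadForm n) (x : Fin n → ℂ) (y : EuclideanSpace ℝ (Fin n)) :
    φ (x, ofRealVec y) = φ (x, 0)
      + ∑ k, QuadraticMap.polar φ (x, 0) (0, Pi.single k 1) * (y k : ℂ)
      + 1 / 2 * ∑ j, ∑ k, hessYY φ j k * (y j : ℂ) * (y k : ℂ) := by
  have hy : ((0, ofRealVec y) : (Fin n → ℂ) × (Fin n → ℂ)) =
      ∑ k, (y k : ℂ) • ((0, Pi.single k 1) : (Fin n → ℂ) × (Fin n → ℂ)) := by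
    ext i
    · simp [Prod.fst_sum]
    · simp [Prod.snd_sum, ofRealVec, Finset.sum_apply, Pi.single_apply]
  have hlin : ∀ v : (Fin n → ℂ) × (Fin n → ℂ), QuadraticMap.polar φ v (0, ofRealVec y) =
      ∑ k, QuadraticMap.polar φ v (0, Pi.single k 1) * (y k : ℂ) := by
    intro v
    have : ∀ w, QuadraticMap.polar φ v w = φ.polarBilin v w := fun w => rfl
    simp only [this]
    rw [hy, map_sum]
    refine Finset.sum_congr rfl fun k _ => ?_
    rw [map_smul, smul_eq_mul, mul_comm]
  have hsq : φ (0, ofRealVec y) = 1 / 2 * ∑ j, ∑ k, hessYY φ j k * (y j : ℂ) * (y k : ℂ) := by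
    have h := QuadraticMap.polar_self φ ((0, ofRealVec y) : (Fin n → ℂ) × (Fin n → ℂ))
    rw [hlin] at h
    have h2 : ∀ k, QuadraticMap.polar φ (0, ofRealVec y) (0, Pi.single k 1) =
        ∑ j, hessYY φ j k * (y j : ℂ) := by
      intro k
      rw [QuadraticMap.polar_comm, hlin]
      refine Finset.sum_congr rfl fun j _ => ?_
      rw [QuadraticMap.polar_comm]
      rfl
    simp only [h2, Finset.sum_mul, nsmul_eq_mul, Nat.cast_ofNat] at h
    rw [Finset.sum_comm] at h
    rw [h]
    ring
  have hadd : ((x, ofRealVec y) : (Fin n → ℂ) × (Fin n → ℂ)) = (x, 0) + (0, ofRealVec y) := by simp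
  have hpol : φ ((x, 0) + (0, ofRealVec y)) = φ (x, 0) + φ (0, ofRealVec y) +
      QuadraticMap.polar φ (x, 0) (0, ofRealVec y) := by
    simp [QuadraticMap.polar]
  rw [hadd, hpol, hlin, hsq]
  ring

theorem form_temperate {n : ℕ} (φ : HolQuadForm n) (x : Fin n → ℂ) :
    (fun y : EuclideanSpace ℝ (Fin n) => Complex.I * φ (x, ofRealVec y)).HasTemperateGrowth := by
  have hco : ∀ k, (fun y : EuclideanSpace ℝ (Fin n) => (y k : ℂ)).HasTemperateGrowth := fun k =>
    (Complex.ofRealCLM.comp (EuclideanSpace.proj (𝕜 := ℝ) k)).hasTemperateGrowth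
  simp only [form_expand]
  fun_prop

/-- `-Im φ(x, y)` is bounded above, in `y ∈ ℝⁿ`, by a quadratic polynomial in `‖y‖` with negative
leading coefficient. -/
theorem Phase.neg_im_le {n : ℕ} (φ : Phase n) (x : Fin n → ℂ) :
    ∃ A M c : ℝ, 0 < c ∧ ∀ y : EuclideanSpace ℝ (Fin n),
      -(φ.form (x, ofRealVec y)).im ≤ A + M * ‖y‖ - c * ‖y‖ ^ 2 := by
  set H := (hessYY φ.form).map Complex.im with hH
  let Q : EuclideanSpace ℝ (Fin n) → ℝ := fun y => ∑ j, ∑ k, H j k * y j * y k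
  have hQpos : ∀ y, y ≠ 0 → 0 < Q y := by
    intro y hy
    have h0 : y.ofLp ≠ 0 := by
      intro h
      exact hy (by ext i; simpa using congrFun h i)
    have := φ.im_hessYY_posDef.dotProduct_mulVec_pos h0
    refine this.trans_eq ?_
    simp only [Q, dotProduct, Matrix.mulVec, Finset.mul_sum, Pi.star_apply, star_trivial]
    refine Finset.sum_congr rfl fun j _ => Finset.sum_congr rfl fun k _ => ?_
    rw [← hH]
    ring
  have hQcont : Continuous Q := by fun_prop
  have hQhom : ∀ (t : ℝ) y, Q (t • y) = t ^ 2 * Q y := by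
    intro t y
    simp only [Q, Finset.mul_sum, PiLp.smul_apply, smul_eq_mul]
    refine Finset.sum_congr rfl fun j _ => Finset.sum_congr rfl fun k _ => ?_
    ring
  obtain ⟨c, hc, hcQ⟩ : ∃ c : ℝ, 0 < c ∧ ∀ y, c * ‖y‖ ^ 2 ≤ Q y := by
    rcases (Metric.sphere (0 : EuclideanSpace ℝ (Fin n)) 1).eq_empty_or_nonempty with he | hne
    · refine ⟨1, one_pos, fun y => ?_⟩
      have hy : y = 0 := by
        by_contra hy
        have : ‖y‖⁻¹ • y ∈ Metric.sphere (0 : EuclideanSpace ℝ (Fin n)) 1 := by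
          simp [norm_smul, hy]
        simp [he] at this
      simp [hy, Q]
    · obtain ⟨z, hz, hmin⟩ := (isCompact_sphere (0 : EuclideanSpace ℝ (Fin n)) 1).exists_isMinOn
        hne hQcont.continuousOn
      have hz0 : z ≠ 0 := by
        rintro rfl
        simp at hz
      refine ⟨Q z, hQpos z hz0, fun y => ?_⟩
      by_cases hy : y = 0
      · simp [hy, Q]
      · have hs : ‖y‖⁻¹ • y ∈ Metric.sphere (0 : EuclideanSpace ℝ (Fin n)) 1 := by
          simp [norm_smul, hy]
        have h1 : Q z ≤ Q (‖y‖⁻¹ • y) := hmin hs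
        rw [hQhom, inv_pow] at h1
        have hp : 0 < ‖y‖ ^ 2 := by positivity
        rwa [inv_mul_eq_div, le_div_iff₀ hp] at h1
  let b : Fin n → ℂ := fun k => QuadraticMap.polar φ.form (x, 0) (0, Pi.single k 1)
  refine ⟨-(φ.form (x, 0)).im, ∑ k, ‖b k‖, c / 2, by positivity, fun y => ?_⟩
  have hlin : -(∑ k, b k * (y k : ℂ)).im ≤ (∑ k, ‖b k‖) * ‖y‖ := by
    refine (neg_le_abs _).trans ((Complex.abs_im_le_norm _).trans ((norm_sum_le _ _).trans ?_))
    rw [Finset.sum_mul]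
    refine Finset.sum_le_sum fun k _ => ?_
    rw [norm_mul, Complex.norm_real]
    exact mul_le_mul_of_nonneg_left (PiLp.norm_apply_le y k) (norm_nonneg _)
  have hquad : (1 / 2 * ∑ j, ∑ k, hessYY φ.form j k * (y j : ℂ) * (y k : ℂ)).im = Q y / 2 := by
    have h1 : (∑ j, ∑ k, hessYY φ.form j k * (y j : ℂ) * (y k : ℂ)).im = Q y := by
      simp [Q, H, Complex.im_sum, mul_assoc, ← Complex.ofReal_mul]
    rw [show (1 / 2 : ℂ) = ((1 / 2 : ℝ) : ℂ) by simp, Complex.im_ofReal_mul, h1]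
    ring
  rw [form_expand, Complex.add_im, Complex.add_im, hquad]
  have := hcQ y
  change -((φ.form (x, 0)).im + (∑ k, b k * (y k : ℂ)).im + Q y / 2) ≤ _
  linarith

/-- The Schwartz function `y ↦ e^{iφ(x, y)}` on `ℝⁿ`. -/
noncomputable def Phase.kernel {n : ℕ} (φ : Phase n) (x : Fin n → ℂ) :
    𝓢(EuclideanSpace ℝ (Fin n), ℂ) where
  toFun y := Complex.exp (Complex.I * φ.form (x, ofRealVec y))
  smooth' := (form_temperate φ.form x).1.cexp
  decay' k m := by
    obtain ⟨A, M, c, hc, h⟩ := φ.neg_im_le x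
    have := decay_cexp_smul (form_temperate φ.form x) hc (by simpa using h) m
      (fun _ => (1 : ℂ)) (Function.HasTemperateGrowth.const 1) k
    simpa using this

/-- The metaplectic FBI-Bargmann transform `𝒯u(x) = C ∫ e^{iφ(x, y)} u(y) dy` of a tempered
distribution `u`, where the integral stands for the pairing of `u` with the Schwartz function
`e^{iφ(x, ·)}`. The normalising constant `C` is a parameter; the value `C = C_φ > 0` for which `𝒯`
is unitary from `L²(ℝⁿ)` onto `H²_Φ(ℂⁿ)` is one admissible choice. -/
noncomputable def Phase.transform {n : ℕ} (φ : Phase n) (C : ℝ)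
    (u : 𝓢'(EuclideanSpace ℝ (Fin n), ℂ)) (x : Fin n → ℂ) : ℂ :=
  C * u (φ.kernel x)

/-- On Schwartz functions the transform is given by the integral. -/
theorem Phase.transform_coe {n : ℕ} (φ : Phase n) (C : ℝ) (f : 𝓢(EuclideanSpace ℝ (Fin n), ℂ))
    (x : Fin n → ℂ) :
    φ.transform C (f : 𝓢'(EuclideanSpace ℝ (Fin n), ℂ)) x =
      C * ∫ y, Complex.exp (Complex.I * φ.form (x, ofRealVec y)) * f y := by
  rw [Phase.transform, SchwartzMap.coe_apply]
  rfl

/-- The quadratic weight `Φ(x) = sup_{y ∈ ℝⁿ} (-Im φ(x, y))`. -/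
noncomputable def Phase.weight {n : ℕ} (φ : Phase n) (x : Fin n → ℂ) : ℝ :=
  ⨆ y : EuclideanSpace ℝ (Fin n), -(φ.form (x, ofRealVec y)).im

/-- The supremum in the definition of the weight is finite. -/
theorem Phase.weight_bddAbove {n : ℕ} (φ : Phase n) (x : Fin n → ℂ) :
    BddAbove (Set.range fun y : EuclideanSpace ℝ (Fin n) => -(φ.form (x, ofRealVec y)).im) := by
  obtain ⟨A, M, c, hc, h⟩ := φ.neg_im_le x
  refine ⟨A + M ^ 2 / (4 * c), ?_⟩
  rintro _ ⟨y, rfl⟩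
  have h4 : M * ‖y‖ - c * ‖y‖ ^ 2 ≤ M ^ 2 / (4 * c) := by
    rw [le_div_iff₀ (by positivity)]
    nlinarith [sq_nonneg (M - 2 * c * ‖y‖)]
  have := h y
  dsimp only
  linarith

/-- The space `H^p_Φ(ℂⁿ)` of entire functions `v` with `e^{-Φ} v ∈ L^p(ℂⁿ)`, for Lebesgue
measure. -/
def weightedSpace {n : ℕ} (Φ : (Fin n → ℂ) → ℝ) (p : ℝ≥0∞) : Set ((Fin n → ℂ) → ℂ) :=
  {v | Differentiable ℂ v ∧ MemLp (fun x => Real.exp (-Φ x) * v x) p volume}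

/-- The norm of `H^p_Φ(ℂⁿ)`: the `L^p` norm of `e^{-Φ} v`, that is
`(∫ |v|^p e^{-pΦ})^{1/p}` for `p < ∞` and the essential supremum of `|v| e^{-Φ}` for `p = ∞`. It
takes values in `[0, ∞]`, and is finite on `H^p_Φ(ℂⁿ)`. -/
noncomputable def weightedNorm {n : ℕ} (Φ : (Fin n → ℂ) → ℝ) (p : ℝ≥0∞) (v : (Fin n → ℂ) → ℂ) :
    ℝ≥0∞ :=
  eLpNorm (fun x => Real.exp (-Φ x) * v x) p volume

/-- The modulation space `M^p(ℝⁿ)`, defined by means of the transform `𝒯` with phase `φ` and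
constant `C`: all `u ∈ 𝒮'(ℝⁿ)` with `𝒯u ∈ H^p_Φ(ℂⁿ)`. -/
def Phase.modulationSpace {n : ℕ} (φ : Phase n) (C : ℝ) (p : ℝ≥0∞) :
    Set (𝓢'(EuclideanSpace ℝ (Fin n), ℂ)) :=
  {u | φ.transform C u ∈ weightedSpace φ.weight p}

end FBI

/-! Write A = φ''_yy and let q be the real critical point of y ↦ -Im φ(x, y), with ξ = φ'_y(x, q),
which is real. Completing the square at q turns the kernel e^{iφ(x, y)} into a factor of modulus
e^{Φ(x)} times the Gaussian wave packet g_a(y) = exp(i/2 A(y - q)·(y - q) + iξ·y) with a = (q, ξ),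
and x ↦ a is a real linear isomorphism of ℂⁿ onto phase space (`Phase.toPhaseSpace`). Hence
e^{-Φ(x)} |𝒯u(x)| = C |u(g_a)| (`Phase.norm_weighted_transform`). Up to a Jacobian factor bounded
uniformly in p, the H^p_Φ norm of 𝒯u is the L^p norm over phase space of a ↦ u(g_a), and the only
trace of φ left in that function is the matrix A.

It remains to compare two matrices A and B. The short-time Fourier transform of a B-Gaussian with
window exp(-(s/2) t·t - (i/2) B t·t) is explicit, since the window cancels the quadratic part B.
Resynthesis with A-packets returns the B-Gaussian up to the pairing ∫ exp(-(s/2) t·t + (i/2)(A -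
B)t·t) dt of the two windows, which is nonzero for large s (`integral_weightedPacket`,
`eventually_integral_ne_zero`). For a B-packet centred at a₀, the modulus of the coefficient at a
depends only on a - a₀ and has Gaussian decay (`re_kernelExponent_shift`,
`exists_re_kernelExponent_le`). Applying u under the integral dominates |u(g^B)| by a convolution of
|u(g^A)| with an integrable Gaussian, and Young's inequality gives a bound with a constant
independent of p.

Moving u under the integral is legitimate because u is a bounded functional of finitely many
weighted derivatives, which lie in a Banach space where Bochner integration is available
(`functional_integral_comm`). The same synthesis formula with A = B writes u of a plane Gaussian as
a Laplace integral in its complex frequency, so 𝒯u is entire and membership in H^p_Φ is just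
finiteness of the norm. -/

namespace FBI

/-! ### Tempered distributions commute with integrals of Schwartz functions -/

section WeakIntegral

/-- The normed space of derivatives of order `l` of maps `E → V`. -/
def DerivSpace (E V : Type) [NormedAddCommGroup E] [NormedSpace ℝ E] [NormedAddCommGroup V]
    [NormedSpace ℝ V] (l : ℕ) : Type :=
  ContinuousMultilinearMap ℝ (fun _ : Fin l => E) V

noncomputable instance {E V : Type} [NormedAddCommGroup E] [NormedSpace ℝ E]
    [NormedAddCommGroup V] [NormedSpace ℝ V] (l : ℕ) : NormedAddCommGroup (DerivSpace E V l) :=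
  inferInstanceAs (NormedAddCommGroup (ContinuousMultilinearMap ℝ (fun _ : Fin l => E) V))

noncomputable instance {E V : Type} [NormedAddCommGroup E] [NormedSpace ℝ E]
    [NormedAddCommGroup V] [NormedSpace ℝ V] (l : ℕ) : NormedSpace ℝ (DerivSpace E V l) :=
  inferInstanceAs (NormedSpace ℝ (ContinuousMultilinearMap ℝ (fun _ : Fin l => E) V))

noncomputable instance {E V : Type} [NormedAddCommGroup E] [NormedSpace ℝ E]
    [NormedAddCommGroup V] [NormedSpace ℝ V] [NormedSpace ℂ V] [SMulCommClass ℝ ℂ V] (l : ℕ) :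
    NormedSpace ℂ (DerivSpace E V l) :=
  inferInstanceAs (NormedSpace ℂ (ContinuousMultilinearMap ℝ (fun _ : Fin l => E) V))

instance {E V : Type} [NormedAddCommGroup E] [NormedSpace ℝ E] [NormedAddCommGroup V]
    [NormedSpace ℝ V] [CompleteSpace V] (l : ℕ) : CompleteSpace (DerivSpace E V l) :=
  inferInstanceAs (CompleteSpace (ContinuousMultilinearMap ℝ (fun _ : Fin l => E) V))

theorem schwartz_contDiff {E V : Type} [NormedAddCommGroup E] [NormedSpace ℝ E]
    [NormedAddCommGroup V] [NormedSpace ℝ V] (f : 𝓢(E, V)) (l : ℕ) : ContDiff ℝ l f :=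
  mod_cast f.smooth l

/-- The derivative of order `l` of a Schwartz function. -/
noncomputable def iter {E V : Type} [NormedAddCommGroup E] [NormedSpace ℝ E]
    [NormedAddCommGroup V] [NormedSpace ℝ V] (l : ℕ) (f : E → V) (y : E) : DerivSpace E V l :=
  iteratedFDeriv ℝ l f y

/-- Currying of derivatives. -/
noncomputable def curryDeriv (E V : Type) [NormedAddCommGroup E] [NormedSpace ℝ E]
    [NormedAddCommGroup V] [NormedSpace ℝ V] (l : ℕ) :
    DerivSpace E V (l + 1) ≃ₗᵢ[ℝ] (E →L[ℝ] DerivSpace E V l) :=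
  continuousMultilinearCurryLeftEquiv ℝ (fun _ : Fin (l + 1) => E) V

variable {A E V : Type} [NormedAddCommGroup E] [NormedSpace ℝ E] [NormedAddCommGroup V]
  [NormedSpace ℝ V]

theorem continuous_iter (f : 𝓢(E, V)) (l : ℕ) : Continuous (iter l f) :=
  (schwartz_contDiff f l).continuous_iteratedFDeriv le_rfl

theorem hasFDerivAt_iter (f : 𝓢(E, V)) (l : ℕ) (y : E) :
    HasFDerivAt (iter l f) (curryDeriv E V l (iter (l + 1) f y)) y := by
  have h1 : Differentiable ℝ (iteratedFDeriv ℝ l f) :=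
    (schwartz_contDiff f (l + 1)).differentiable_iteratedFDeriv
      (by exact_mod_cast Nat.lt_succ_self l)
  have h2 := (h1 y).hasFDerivAt
  have h3 : fderiv ℝ (iteratedFDeriv ℝ l f) y = curryDeriv E V l (iter (l + 1) f y) := by
    refine Eq.trans ?_ (congrArg (curryDeriv E V l)
      (congrFun (iteratedFDeriv_succ_eq_comp_left (𝕜 := ℝ) (f := f) (n := l)) y).symm)
    exact ((curryDeriv E V l).apply_symm_apply _).symm
  rwa [h3] at h2

variable [NormedSpace ℂ V] [SMulCommClass ℝ ℂ V]

theorem norm_iter_le (f : 𝓢(E, V)) (k l : ℕ) (y : E) :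
    ‖y‖ ^ k * ‖iter l f y‖ ≤ SchwartzMap.seminorm ℂ k l f :=
  SchwartzMap.le_seminorm ℂ k l f y

/-- The weighted derivative `y ↦ ‖y‖ ^ k • Dˡ f y` of a Schwartz function. -/
noncomputable def weightedDeriv (k l : ℕ) (f : 𝓢(E, V)) :
    BoundedContinuousFunction E (DerivSpace E V l) :=
  BoundedContinuousFunction.ofNormedAddCommGroup (fun y => ‖y‖ ^ k • iter l f y)
    ((continuous_norm.pow k).smul (continuous_iter f l))
    (SchwartzMap.seminorm ℂ k l f) (fun y => by
      rw [norm_smul, norm_pow, norm_norm]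
      exact norm_iter_le f k l y)

theorem weightedDeriv_apply (k l : ℕ) (f : 𝓢(E, V)) (y : E) :
    weightedDeriv k l f y = ‖y‖ ^ k • iter l f y := rfl

/-- With `seminorm_le_norm_weightedDeriv`, this identifies each Schwartz seminorm with a norm in a
Banach space (for complete V), so that Hahn–Banach and Bochner integration become available. -/
theorem norm_weightedDeriv_le (k l : ℕ) (f : 𝓢(E, V)) :
    ‖weightedDeriv k l f‖ ≤ SchwartzMap.seminorm ℂ k l f :=
  BoundedContinuousFunction.norm_ofNormedAddCommGroup_le _ (by positivity) _

theorem seminorm_le_norm_weightedDeriv (k l : ℕ) (f : 𝓢(E, V)) :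
    SchwartzMap.seminorm ℂ k l f ≤ ‖weightedDeriv k l f‖ := by
  refine SchwartzMap.seminorm_le_bound ℂ k l f (norm_nonneg _) fun y => ?_
  have := (weightedDeriv k l f).norm_coe_le_norm y
  rwa [weightedDeriv_apply, norm_smul, norm_pow, norm_norm] at this

theorem weightedDeriv_add (k l : ℕ) (f g : 𝓢(E, V)) :
    weightedDeriv k l (f + g) = weightedDeriv k l f + weightedDeriv k l g := by
  ext y : 1
  have h : iter l ⇑(f + g) y = iter l f y + iter l g y :=
    iteratedFDeriv_add_apply (schwartz_contDiff f _).contDiffAt (schwartz_contDiff g _).contDiffAt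
  rw [BoundedContinuousFunction.add_apply, weightedDeriv_apply, weightedDeriv_apply,
    weightedDeriv_apply, h, smul_add]

theorem weightedDeriv_smul (k l : ℕ) (c : ℂ) (f : 𝓢(E, V)) :
    weightedDeriv k l (c • f) = c • weightedDeriv k l f := by
  ext y : 1
  have h : iter l ⇑(c • f) y = c • iter l f y :=
    iteratedFDeriv_const_smul_apply (schwartz_contDiff f _).contDiffAt
  rw [BoundedContinuousFunction.smul_apply, weightedDeriv_apply, weightedDeriv_apply, h]
  exact ContinuousMultilinearMap.ext fun m => smul_comm _ _ _

/-- The space of finite families of weighted derivatives. -/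
abbrev JetSpace (E V : Type) [NormedAddCommGroup E] [NormedSpace ℝ E] [NormedAddCommGroup V]
    [NormedSpace ℝ V] (s : Finset (ℕ × ℕ)) : Type :=
  (i : s) → BoundedContinuousFunction E (DerivSpace E V i.1.2)

/-- The family of weighted derivatives of a Schwartz function indexed by a finite set. -/
noncomputable def jet (s : Finset (ℕ × ℕ)) : 𝓢(E, V) →ₗ[ℂ] JetSpace E V s where
  toFun f i := weightedDeriv i.1.1 i.1.2 f
  map_add' f g := funext fun _ => weightedDeriv_add _ _ f g
  map_smul' c f := funext fun _ => weightedDeriv_smul _ _ c f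

theorem weightedDeriv_continuous (k l : ℕ) : Continuous (weightedDeriv (E := E) (V := V) k l) := by
  rw [continuous_iff_continuousAt]
  intro f
  have h1 : Continuous fun g : 𝓢(E, V) => SchwartzMap.seminorm ℂ k l (g - f) :=
    ((schwartz_withSeminorms ℂ E V).continuous_seminorm (k, l)).comp (continuous_sub_right f)
  have h2 := h1.tendsto f
  rw [sub_self, map_zero] at h2
  refine tendsto_iff_norm_sub_tendsto_zero.2 (squeeze_zero (fun _ => norm_nonneg _) (fun g => ?_) h2)
  have h3 : weightedDeriv k l g - weightedDeriv k l f = weightedDeriv k l (g - f) := by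
    rw [sub_eq_iff_eq_add, ← weightedDeriv_add, sub_add_cancel]
  rw [h3]
  exact norm_weightedDeriv_le k l (g - f)

theorem continuous_jet (s : Finset (ℕ × ℕ)) : Continuous (jet (E := E) (V := V) s) :=
  continuous_pi fun i => weightedDeriv_continuous i.1.1 i.1.2

theorem exists_norm_le_sum_seminorm (u : 𝓢(E, V) →L[ℂ] ℂ) :
    ∃ (s : Finset (ℕ × ℕ)) (C : ℝ), 0 ≤ C ∧
      ∀ f, ‖u f‖ ≤ C * ∑ i ∈ s, SchwartzMap.seminorm ℂ i.1 i.2 f := by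
  obtain ⟨s, C, -, hC⟩ := Seminorm.bound_of_continuous (schwartz_withSeminorms ℂ E V)
    ((normSeminorm ℂ ℂ).comp (u : 𝓢(E, V) →ₗ[ℂ] ℂ)) (by
      change Continuous fun f => ‖u f‖
      exact u.continuous.norm)
  refine ⟨s, C, C.2, fun f => (hC f).trans ?_⟩
  rw [smul_apply, NNReal.smul_def, smul_eq_mul]
  refine mul_le_mul_of_nonneg_left ?_ C.2
  refine Seminorm.finset_sup_apply_le (Finset.sum_nonneg fun i _ => apply_nonneg _ f) fun i hi => ?_
  exact Finset.single_le_sum (f := fun i : ℕ × ℕ => SchwartzMap.seminorm ℂ i.1 i.2 f)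
    (fun i _ => apply_nonneg _ f) hi

/-- A continuous linear functional on the Schwartz space is a bounded linear functional of
finitely many weighted derivatives. -/
theorem exists_functional_jet (u : 𝓢(E, V) →L[ℂ] ℂ) :
    ∃ (s : Finset (ℕ × ℕ)) (U : JetSpace E V s →L[ℂ] ℂ), ∀ f, u f = U (jet s f) := by
  obtain ⟨s, C, hC, hu⟩ := exists_norm_le_sum_seminorm u
  have hb : ∀ f, ‖u f‖ ≤ C * s.card * ‖jet s f‖ := by
    intro f
    refine (hu f).trans ?_
    rw [mul_assoc, ← nsmul_eq_mul]
    refine mul_le_mul_of_nonneg_left (Finset.sum_le_card_nsmul _ _ _ fun i hi => ?_) hC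
    exact (seminorm_le_norm_weightedDeriv i.1 i.2 f).trans (norm_le_pi_norm (jet s f) ⟨i, hi⟩)
  -- By the bound `hb`, u vanishes where the jet does, so it descends to a functional on the range
  -- of `jet s`, bounded for the jet norm.
  have hker : LinearMap.ker (jet (E := E) (V := V) s) ≤
      LinearMap.ker (u : 𝓢(E, V) →ₗ[ℂ] ℂ) := by
    intro f hf
    have := hb f
    rw [LinearMap.mem_ker.1 hf, norm_zero, mul_zero] at this
    exact norm_le_zero_iff.1 this
  let e := (jet (E := E) (V := V) s).quotKerEquivRange
  let v : LinearMap.range (jet (E := E) (V := V) s) →ₗ[ℂ] ℂ :=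
    ((LinearMap.ker (jet (E := E) (V := V) s)).liftQ (u : 𝓢(E, V) →ₗ[ℂ] ℂ) hker).comp
      e.symm.toLinearMap
  have hv : ∀ f, v ⟨jet s f, f, rfl⟩ = u f := by
    intro f
    have : e.symm ⟨jet s f, f, rfl⟩ = (LinearMap.ker (jet (E := E) (V := V) s)).mkQ f := by
      rw [LinearEquiv.symm_apply_eq]
      rfl
    change (LinearMap.ker (jet (E := E) (V := V) s)).liftQ _ hker (e.symm ⟨jet s f, f, rfl⟩) = _
    rw [this]
    rfl
  -- Hahn–Banach extends the functional from the range of the jet map to the whole product space.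
  obtain ⟨U, hU, -⟩ := exists_extension_norm_eq (LinearMap.range (jet (E := E) (V := V) s))
    (v.mkContinuous (C * s.card) (by
      rintro ⟨_, f, rfl⟩
      rw [hv]
      exact hb f))
  exact ⟨s, U, fun f => ((hU ⟨jet s f, f, rfl⟩).trans (hv f)).symm⟩

variable [MeasurableSpace A] [TopologicalSpace A] [OpensMeasurableSpace A]
  [SecondCountableTopology A] {μ : Measure A}

theorem norm_iter_le_seminorm_zero (f : 𝓢(E, V)) (l : ℕ) (y : E) :
    ‖iter l f y‖ ≤ SchwartzMap.seminorm ℂ 0 l f := by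
  simpa using norm_iter_le f 0 l y

/-- Differentiation under the integral sign for continuous families of Schwartz functions. -/
theorem iter_integral [CompleteSpace V] {F : A → 𝓢(E, V)} (hF : Continuous F)
    (hint : ∀ k l, Integrable (fun a => SchwartzMap.seminorm ℂ k l (F a)) μ) (l : ℕ) :
    iter l (fun y => ∫ a, F a y ∂μ) = fun y => ∫ a, iter l (F a) y ∂μ := by
  have hcont : ∀ l y, Continuous fun a => iter l (F a) y := by
    intro l y
    have := (BoundedContinuousFunction.evalCLM ℝ (β := DerivSpace E V l) y).continuous.comp
      ((weightedDeriv_continuous 0 l).comp hF)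
    simpa [Function.comp_def, weightedDeriv_apply] using this
  have hi : ∀ l y, Integrable (fun a => iter l (F a) y) μ := fun l y =>
    (hint 0 l).mono' (hcont l y).aestronglyMeasurable
      (Filter.Eventually.of_forall fun a => norm_iter_le_seminorm_zero _ _ _)
  induction l with
  | zero =>
    funext y
    let e : V ≃ₗᵢ[ℝ] DerivSpace E V 0 := (continuousMultilinearCurryFin0 ℝ E V).symm
    have h2 : ∀ a, iter 0 (F a) y = e (F a y) := fun a => rfl
    simp only [h2]
    have hFi : Integrable (fun a => F a y) μ := by
      have := e.symm.toContinuousLinearEquiv.toContinuousLinearMap.integrable_comp (hi 0 y)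
      exact this
    exact (e.toContinuousLinearEquiv.toContinuousLinearMap.integral_comp_comm hFi).symm
  | succ l ih =>
    funext y
    let e := curryDeriv E V l
    -- The seminorm of order (0, l + 1) bounds the next derivative uniformly in y, so one dominating
    -- function serves on all of E.
    have h1 := hasFDerivAt_integral_of_dominated_of_fderiv_le (μ := μ) (𝕜 := ℝ)
      (F := fun y a => iter l (F a) y)
      (F' := fun y a => e (iter (l + 1) (F a) y))
      (bound := fun a => SchwartzMap.seminorm ℂ 0 (l + 1) (F a)) (x₀ := y) (s := Set.univ)
      Filter.univ_mem
      (Filter.Eventually.of_forall fun y => (hcont l y).aestronglyMeasurable) (hi l y)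
      ((e.continuous.comp (hcont (l + 1) y)).aestronglyMeasurable)
      (Filter.Eventually.of_forall fun a y _ => by
        rw [e.norm_map]
        exact norm_iter_le_seminorm_zero _ _ _)
      (hint 0 (l + 1))
      (Filter.Eventually.of_forall fun a y _ => hasFDerivAt_iter (F a) l y)
    rw [← ih] at h1
    have h2 := e.toContinuousLinearEquiv.toContinuousLinearMap.integral_comp_comm
      (hi (l + 1) y)
    have h3 := h1.fderiv.trans h2
    have h4 : iter (l + 1) (fun y => ∫ a, F a y ∂μ) y =
        e.symm (fderiv ℝ (iter l (fun y => ∫ a, F a y ∂μ)) y) :=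
      congrFun (iteratedFDeriv_succ_eq_comp_left (𝕜 := ℝ) (f := fun y => ∫ a, F a y ∂μ)
        (n := l)) y
    rw [h4, h3]
    exact e.symm_apply_apply _

/-- A continuous linear functional commutes with absolutely convergent integrals of Schwartz
functions. -/
theorem functional_integral_comm [CompleteSpace V] (u : 𝓢(E, V) →L[ℂ] ℂ) {F : A → 𝓢(E, V)}
    (hF : Continuous F)
    (hint : ∀ k l, Integrable (fun a => SchwartzMap.seminorm ℂ k l (F a)) μ) {h : 𝓢(E, V)}
    (hh : ∀ y, h y = ∫ a, F a y ∂μ) :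
    Integrable (fun a => u (F a)) μ ∧ u h = ∫ a, u (F a) ∂μ := by
  obtain ⟨s, U, hU⟩ := exists_functional_jet u
  have hJ : Continuous fun a => jet s (F a) := (continuous_jet s).comp hF
  have hJi : Integrable (fun a => jet s (F a)) μ := by
    refine (integrable_finsetSum s.attach fun i _ => hint i.1.1 i.1.2).mono'
      hJ.aestronglyMeasurable (Filter.Eventually.of_forall fun a => ?_)
    refine (pi_norm_le_iff_of_nonneg (Finset.sum_nonneg fun i _ => by positivity)).2 fun i => ?_
    refine (norm_weightedDeriv_le i.1.1 i.1.2 (F a)).trans ?_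
    exact Finset.single_le_sum (f := fun i : s => SchwartzMap.seminorm ℂ i.1.1 i.1.2 (F a))
      (fun i _ => by positivity) (Finset.mem_attach s i)
  -- Evaluation at a component and a point is a bounded functional on the jet space, so the Bochner
  -- integral can be identified pointwise; there it is differentiation under the integral sign.
  have key : jet s h = ∫ a, jet s (F a) ∂μ := by
    ext i y : 2
    have h1 := ((BoundedContinuousFunction.evalCLM ℝ (β := DerivSpace E V i.1.2) y).comp
      (ContinuousLinearMap.proj (R := ℝ) (φ := fun i : s => BoundedContinuousFunction E
        (DerivSpace E V i.1.2)) i)).integral_comp_comm hJi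
    change _ = (∫ a, jet s (F a) ∂μ) i y at h1
    rw [← h1]
    have h2 : (h : E → V) = fun y => ∫ a, F a y ∂μ := funext hh
    change ‖y‖ ^ i.1.1 • iter i.1.2 h y = ∫ a, ‖y‖ ^ i.1.1 • iter i.1.2 (F a) y ∂μ
    rw [h2, iter_integral hF hint, integral_smul]
  simp only [hU]
  refine ⟨U.integrable_comp hJi, ?_⟩
  rw [key, ← U.integral_comp_comm hJi]

end WeakIntegral

/-! ### Slices of Schwartz functions depend continuously on the parameter -/

section Slice

variable {A E V : Type} [NormedAddCommGroup A] [NormedSpace ℝ A] [NormedAddCommGroup E]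
  [NormedSpace ℝ E] [NormedAddCommGroup V] [NormedSpace ℝ V]

theorem iteratedFDeriv_slice (f : 𝓢(A × E, V)) (a : A) (l : ℕ) (y : E) :
    iteratedFDeriv ℝ l (fun y => f (a, y)) y =
      (iteratedFDeriv ℝ l f (a, y)).compContinuousLinearMap
        (fun _ => ContinuousLinearMap.inr ℝ A E) := by
  have h1 : (fun y => f (a, y)) =
      (fun z => f ((a, 0) + z)) ∘ (ContinuousLinearMap.inr ℝ A E) := by
    funext y
    simp
  have h2 : ContDiff ℝ l (fun z => f ((a, 0) + z)) :=
    (schwartz_contDiff f l).comp (contDiff_const.add contDiff_id)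
  rw [h1, ContinuousLinearMap.iteratedFDeriv_comp_right _ h2 y le_rfl,
    iteratedFDeriv_comp_add_left]
  simp

theorem norm_inr_le_one : ‖ContinuousLinearMap.inr ℝ A E‖ ≤ 1 :=
  ContinuousLinearMap.opNorm_le_bound _ zero_le_one fun y => by simp

theorem norm_comp_inr_le {l : ℕ} (T : ContinuousMultilinearMap ℝ (fun _ : Fin l => A × E) V) :
    ‖T.compContinuousLinearMap (fun _ => ContinuousLinearMap.inr ℝ A E)‖ ≤ ‖T‖ := by
  refine (T.norm_compContinuousLinearMap_le _).trans ?_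
  refine mul_le_of_le_one_right (norm_nonneg _) ?_
  exact Finset.prod_le_one (fun _ _ => norm_nonneg _) fun _ _ => norm_inr_le_one

theorem norm_snd_pow_mul_le (f : 𝓢(A × E, V)) (k l : ℕ) (a : A) (y : E) :
    ‖y‖ ^ k * ‖iteratedFDeriv ℝ l f (a, y)‖ ≤ SchwartzMap.seminorm ℝ k l f := by
  refine le_trans ?_ (SchwartzMap.le_seminorm ℝ k l f (a, y))
  gcongr
  exact norm_snd_le (a, y)

/-- The slice `Θ(a, ·)` of a Schwartz function `Θ`. -/
noncomputable def slice (f : 𝓢(A × E, V)) (a : A) : 𝓢(E, V) where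
  toFun y := f (a, y)
  smooth' := (f.smooth ⊤).comp (contDiff_prodMk_right a)
  decay' k l := ⟨SchwartzMap.seminorm ℝ k l f, fun y => by
    rw [iteratedFDeriv_slice]
    exact (mul_le_mul_of_nonneg_left (norm_comp_inr_le _) (by positivity)).trans
      (norm_snd_pow_mul_le f k l a y)⟩

variable [NormedSpace ℂ V] [SMulCommClass ℝ ℂ V]

theorem seminorm_slice_le (f : 𝓢(A × E, V)) (a : A) (k l : ℕ) :
    SchwartzMap.seminorm ℂ k l (slice f a) ≤ SchwartzMap.seminorm ℝ k l f := by
  refine SchwartzMap.seminorm_le_bound ℂ k l _ (by positivity) fun y => ?_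
  change ‖y‖ ^ k * ‖iteratedFDeriv ℝ l (fun y => f (a, y)) y‖ ≤ _
  rw [iteratedFDeriv_slice]
  exact (mul_le_mul_of_nonneg_left (norm_comp_inr_le _) (by positivity)).trans
    (norm_snd_pow_mul_le f k l a y)

/-- Mean value inequality in the parameter: a parameter derivative of the order-l derivative is
controlled by the full derivative of order l + 1, with the same weight in y. -/
theorem seminorm_slice_sub_le (f : 𝓢(A × E, V)) (a b : A) (k l : ℕ) :
    SchwartzMap.seminorm ℂ k l (slice f a - slice f b) ≤
      SchwartzMap.seminorm ℝ k (l + 1) f * ‖a - b‖ := by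
  refine SchwartzMap.seminorm_le_bound ℂ k l _ (by positivity) fun y => ?_
  have h1 : iteratedFDeriv ℝ l (slice f a - slice f b) y =
      (iteratedFDeriv ℝ l f (a, y) - iteratedFDeriv ℝ l f (b, y)).compContinuousLinearMap
        (fun _ => ContinuousLinearMap.inr ℝ A E) := by
    have h2 : iteratedFDeriv ℝ l (slice f a - slice f b) y =
        iteratedFDeriv ℝ l (slice f a) y - iteratedFDeriv ℝ l (slice f b) y :=
      iteratedFDeriv_sub_apply (schwartz_contDiff _ _).contDiffAt
        (schwartz_contDiff _ _).contDiffAt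
    rw [h2]
    change iteratedFDeriv ℝ l (fun y => f (a, y)) y - iteratedFDeriv ℝ l (fun y => f (b, y)) y = _
    rw [iteratedFDeriv_slice, iteratedFDeriv_slice]
    rfl
  rw [h1]
  refine (mul_le_mul_of_nonneg_left (norm_comp_inr_le _) (by positivity)).trans ?_
  have hd : ∀ c : A, HasFDerivWithinAt (fun c : A => ‖y‖ ^ k • iter l f (c, y))
      (‖y‖ ^ k • (curryDeriv (A × E) V l (iter (l + 1) f (c, y))).comp
        (ContinuousLinearMap.inl ℝ A E)) Set.univ c := fun c =>
    (((hasFDerivAt_iter f l (c, y)).comp c (hasFDerivAt_prodMk_left c y)).const_smul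
      (‖y‖ ^ k)).hasFDerivWithinAt
  have h3 := Convex.norm_image_sub_le_of_norm_hasFDerivWithin_le
    (C := SchwartzMap.seminorm ℝ k (l + 1) f) (fun c _ => hd c) (fun c _ => ?_)
    (convex_univ (𝕜 := ℝ)) (Set.mem_univ b) (Set.mem_univ a)
  · rw [← smul_sub, norm_smul, norm_pow, norm_norm] at h3
    exact h3
  · rw [norm_smul, norm_pow, norm_norm]
    have h4 : ‖(curryDeriv (A × E) V l (iter (l + 1) f (c, y))).comp
        (ContinuousLinearMap.inl ℝ A E)‖ ≤ ‖iter (l + 1) f (c, y)‖ := by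
      rw [← (curryDeriv (A × E) V l).norm_map]
      refine (ContinuousLinearMap.opNorm_comp_le _ _).trans
        (mul_le_of_le_one_right (norm_nonneg _) ?_)
      exact ContinuousLinearMap.opNorm_le_bound _ zero_le_one fun y => by simp
    exact (mul_le_mul_of_nonneg_left h4 (by positivity)).trans (norm_snd_pow_mul_le f k _ c y)

theorem continuous_slice (f : 𝓢(A × E, V)) : Continuous (slice f) := by
  rw [continuous_iff_continuousAt]
  intro a
  rw [ContinuousAt, (schwartz_withSeminorms ℂ E V).tendsto_nhds]
  rintro ⟨k, l⟩ ε hε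
  have h1 : Filter.Tendsto (fun b => SchwartzMap.seminorm ℝ k (l + 1) f * ‖b - a‖) (nhds a)
      (nhds (SchwartzMap.seminorm ℝ k (l + 1) f * ‖a - a‖)) :=
    (continuous_const.mul (continuous_id.sub continuous_const).norm).tendsto a
  rw [sub_self, norm_zero, mul_zero] at h1
  filter_upwards [h1.eventually_lt_const hε] with b hb
  exact (seminorm_slice_sub_le f b a k l).trans_lt hb

end Slice

/-- The Schwartz function `e ^ P`, where `Re P` is bounded above by a quadratic polynomial with
negative leading coefficient. -/
noncomputable def expSchwartz {E : Type} [NormedAddCommGroup E] [NormedSpace ℝ E] (P : E → ℂ)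
    (hP : P.HasTemperateGrowth)
    (h : ∃ A M c : ℝ, 0 < c ∧ ∀ y, (P y).re ≤ A + M * ‖y‖ - c * ‖y‖ ^ 2) : 𝓢(E, ℂ) where
  toFun y := Complex.exp (P y)
  smooth' := hP.1.cexp
  decay' k m := by
    obtain ⟨A, M, c, hc, h⟩ := h
    simpa using decay_cexp_smul hP hc h m (fun _ => (1 : ℂ)) (Function.HasTemperateGrowth.const 1) k

/-! ### Bilinear forms on ℂⁿ restricted to real vectors -/

section Bilinear

variable {n : ℕ}

/-- The bilinear form `(z, w) ↦ z · A w` on `ℂⁿ`. -/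
def bil (A : Matrix (Fin n) (Fin n) ℂ) (z w : Fin n → ℂ) : ℂ := z ⬝ᵥ A.mulVec w

theorem bil_add_left (A : Matrix (Fin n) (Fin n) ℂ) (z z' w : Fin n → ℂ) :
    bil A (z + z') w = bil A z w + bil A z' w := add_dotProduct _ _ _

theorem bil_add_right (A : Matrix (Fin n) (Fin n) ℂ) (z w w' : Fin n → ℂ) :
    bil A z (w + w') = bil A z w + bil A z w' := by
  simp [bil, Matrix.mulVec_add, dotProduct_add]

theorem bil_sub_left (A : Matrix (Fin n) (Fin n) ℂ) (z z' w : Fin n → ℂ) :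
    bil A (z - z') w = bil A z w - bil A z' w := sub_dotProduct _ _ _

theorem bil_sub_right (A : Matrix (Fin n) (Fin n) ℂ) (z w w' : Fin n → ℂ) :
    bil A z (w - w') = bil A z w - bil A z w' := by
  simp [bil, Matrix.mulVec_sub, dotProduct_sub]

theorem bil_comm {A : Matrix (Fin n) (Fin n) ℂ} (hA : A.IsSymm) (z w : Fin n → ℂ) :
    bil A z w = bil A w z := by
  unfold bil
  rw [Matrix.dotProduct_mulVec, ← Matrix.mulVec_transpose, hA.eq, dotProduct_comm]

theorem dotProduct_mulVec_eq_bil (A : Matrix (Fin n) (Fin n) ℂ) (z w : Fin n → ℂ) :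
    z ⬝ᵥ A.mulVec w = bil A z w := rfl

theorem mulVec_dotProduct_eq_bil (A : Matrix (Fin n) (Fin n) ℂ) (z w : Fin n → ℂ) :
    A.mulVec z ⬝ᵥ w = bil A w z := dotProduct_comm _ _

theorem bil_sub_matrix (A B : Matrix (Fin n) (Fin n) ℂ) (z w : Fin n → ℂ) :
    bil (A - B) z w = bil A z w - bil B z w := by
  simp [bil, Matrix.sub_mulVec, dotProduct_sub]

theorem bil_eq_sum (A : Matrix (Fin n) (Fin n) ℂ) (z w : Fin n → ℂ) :
    bil A z w = ∑ j, ∑ k, A j k * z j * w k := by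
  simp only [bil, dotProduct, Matrix.mulVec, Finset.mul_sum]
  exact Finset.sum_congr rfl fun j _ => Finset.sum_congr rfl fun k _ => by ring

theorem ofRealVec_add (q r : EuclideanSpace ℝ (Fin n)) :
    ofRealVec (q + r) = ofRealVec q + ofRealVec r := by
  ext j
  simp [ofRealVec]

theorem ofRealVec_sub (q r : EuclideanSpace ℝ (Fin n)) :
    ofRealVec (q - r) = ofRealVec q - ofRealVec r := by
  ext j
  simp [ofRealVec]

theorem ofRealVec_dotProduct (q r : EuclideanSpace ℝ (Fin n)) :
    ofRealVec q ⬝ᵥ ofRealVec r = ((∑ j, q j * r j : ℝ) : ℂ) := by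
  simp [ofRealVec, dotProduct]

theorem ofRealVec_dotProduct_im (q r : EuclideanSpace ℝ (Fin n)) :
    (ofRealVec q ⬝ᵥ ofRealVec r).im = 0 := by
  rw [ofRealVec_dotProduct, Complex.ofReal_im]

theorem ofRealVec_dotProduct_self (q : EuclideanSpace ℝ (Fin n)) :
    ofRealVec q ⬝ᵥ ofRealVec q = ((‖q‖ ^ 2 : ℝ) : ℂ) := by
  rw [ofRealVec_dotProduct, EuclideanSpace.norm_sq_eq]
  simp [sq]

theorem norm_ofRealVec_apply_le (q : EuclideanSpace ℝ (Fin n)) (j : Fin n) :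
    ‖ofRealVec q j‖ ≤ ‖q‖ := by
  rw [ofRealVec, Complex.norm_real]
  exact PiLp.norm_apply_le q j

/-- The constant in the boundedness of a bilinear form. -/
noncomputable def bilBound (A : Matrix (Fin n) (Fin n) ℂ) : ℝ := ∑ j, ∑ k, ‖A j k‖

theorem bilBound_nonneg (A : Matrix (Fin n) (Fin n) ℂ) : 0 ≤ bilBound A :=
  Finset.sum_nonneg fun _ _ => Finset.sum_nonneg fun _ _ => norm_nonneg _

theorem norm_bil_le (A : Matrix (Fin n) (Fin n) ℂ) (q r : EuclideanSpace ℝ (Fin n)) :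
    ‖bil A (ofRealVec q) (ofRealVec r)‖ ≤ bilBound A * ‖q‖ * ‖r‖ := by
  rw [bil_eq_sum, bilBound, Finset.sum_mul, Finset.sum_mul]
  refine (norm_sum_le _ _).trans (Finset.sum_le_sum fun j _ => ?_)
  rw [Finset.sum_mul, Finset.sum_mul]
  refine (norm_sum_le _ _).trans (Finset.sum_le_sum fun k _ => ?_)
  rw [norm_mul, norm_mul]
  gcongr
  · exact norm_ofRealVec_apply_le q j
  · exact norm_ofRealVec_apply_le r k

theorem bil_im_eq (A : Matrix (Fin n) (Fin n) ℂ) (q : EuclideanSpace ℝ (Fin n)) :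
    (bil A (ofRealVec q) (ofRealVec q)).im =
      ∑ j, ∑ k, (A.map Complex.im) j k * q j * q k := by
  simp [bil_eq_sum, Complex.im_sum, ofRealVec, mul_assoc, ← Complex.ofReal_mul]

/-- The constant is the minimum of the form on the compact unit sphere, and homogeneity does the
rest. For n = 0 the sphere is empty and any constant works. -/
theorem exists_le_bil_im {A : Matrix (Fin n) (Fin n) ℂ} (hA : (A.map Complex.im).PosDef) :
    ∃ c : ℝ, 0 < c ∧ ∀ q : EuclideanSpace ℝ (Fin n),
      c * ‖q‖ ^ 2 ≤ (bil A (ofRealVec q) (ofRealVec q)).im := by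
  let Q : EuclideanSpace ℝ (Fin n) → ℝ := fun y => ∑ j, ∑ k, (A.map Complex.im) j k * y j * y k
  have hQpos : ∀ y, y ≠ 0 → 0 < Q y := by
    intro y hy
    have h0 : y.ofLp ≠ 0 := fun h => hy (by ext i; simpa using congrFun h i)
    refine (hA.dotProduct_mulVec_pos h0).trans_eq ?_
    simp only [Q, dotProduct, Matrix.mulVec, Finset.mul_sum, Pi.star_apply, star_trivial]
    exact Finset.sum_congr rfl fun j _ => Finset.sum_congr rfl fun k _ => by ring
  have hQcont : Continuous Q := by fun_prop
  have hQhom : ∀ (t : ℝ) y, Q (t • y) = t ^ 2 * Q y := by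
    intro t y
    simp only [Q, Finset.mul_sum, PiLp.smul_apply, smul_eq_mul]
    exact Finset.sum_congr rfl fun j _ => Finset.sum_congr rfl fun k _ => by ring
  simp only [bil_im_eq]
  rcases (Metric.sphere (0 : EuclideanSpace ℝ (Fin n)) 1).eq_empty_or_nonempty with he | hne
  · refine ⟨1, one_pos, fun y => ?_⟩
    have hy : y = 0 := by
      by_contra hy
      have : ‖y‖⁻¹ • y ∈ Metric.sphere (0 : EuclideanSpace ℝ (Fin n)) 1 := by
        simp [norm_smul, hy]
      simp [he] at this
    simp [hy]
  · obtain ⟨z, hz, hmin⟩ := (isCompact_sphere (0 : EuclideanSpace ℝ (Fin n)) 1).exists_isMinOn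
      hne hQcont.continuousOn
    have hz0 : z ≠ 0 := by
      rintro rfl
      simp at hz
    refine ⟨Q z, hQpos z hz0, fun y => ?_⟩
    by_cases hy : y = 0
    · simp [hy]
    · have hs : ‖y‖⁻¹ • y ∈ Metric.sphere (0 : EuclideanSpace ℝ (Fin n)) 1 := by
        simp [norm_smul, hy]
      have h1 : Q z ≤ Q (‖y‖⁻¹ • y) := hmin hs
      rw [hQhom, inv_pow] at h1
      have hp : 0 < ‖y‖ ^ 2 := by positivity
      rwa [inv_mul_eq_div, le_div_iff₀ hp] at h1

theorem bil_im_nonneg {A : Matrix (Fin n) (Fin n) ℂ} (hA : (A.map Complex.im).PosDef)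
    (q : EuclideanSpace ℝ (Fin n)) : 0 ≤ (bil A (ofRealVec q) (ofRealVec q)).im := by
  obtain ⟨c, hc, h⟩ := exists_le_bil_im hA
  exact le_trans (by positivity) (h q)

variable {X : Type} [NormedAddCommGroup X] [NormedSpace ℝ X]

theorem temperate_ofRealVec_apply (L : X →L[ℝ] EuclideanSpace ℝ (Fin n)) (j : Fin n) :
    (fun x => ofRealVec (L x) j).HasTemperateGrowth :=
  (Complex.ofRealCLM.comp ((EuclideanSpace.proj (𝕜 := ℝ) j).comp L)).hasTemperateGrowth

theorem temperate_dotProduct (L M : X →L[ℝ] EuclideanSpace ℝ (Fin n)) :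
    (fun x => ofRealVec (L x) ⬝ᵥ ofRealVec (M x)).HasTemperateGrowth := by
  have h1 := temperate_ofRealVec_apply L
  have h2 := temperate_ofRealVec_apply M
  simp only [dotProduct]
  fun_prop

theorem temperate_bil (A : Matrix (Fin n) (Fin n) ℂ) (L M : X →L[ℝ] EuclideanSpace ℝ (Fin n)) :
    (fun x => bil A (ofRealVec (L x)) (ofRealVec (M x))).HasTemperateGrowth := by
  have h1 := temperate_ofRealVec_apply L
  have h2 := temperate_ofRealVec_apply M
  simp only [bil_eq_sum]
  fun_prop

end Bilinear

/-! ### Gaussian wave packets on phase space -/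

section WavePacket

variable {n : ℕ}

/-- The real phase space `ℝⁿ × ℝⁿ` of positions and frequencies. -/
abbrev PhaseSpace (n : ℕ) : Type := EuclideanSpace ℝ (Fin n) × EuclideanSpace ℝ (Fin n)

/-- The phase of a Gaussian wave packet centred at `(q, ξ)`, up to the factor `i`. -/
noncomputable def packetPhase (A : Matrix (Fin n) (Fin n) ℂ) (a : PhaseSpace n)
    (y : EuclideanSpace ℝ (Fin n)) : ℂ :=
  1 / 2 * bil A (ofRealVec (y - a.1)) (ofRealVec (y - a.1)) + ofRealVec a.2 ⬝ᵥ ofRealVec y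

theorem packetPhase_re (A : Matrix (Fin n) (Fin n) ℂ) (a : PhaseSpace n)
    (y : EuclideanSpace ℝ (Fin n)) :
    (Complex.I * packetPhase A a y).re =
      -(1 / 2) * (bil A (ofRealVec (y - a.1)) (ofRealVec (y - a.1))).im := by
  rw [Complex.I_mul_re, packetPhase, Complex.add_im, ofRealVec_dotProduct_im,
    show (1 / 2 : ℂ) = ((1 / 2 : ℝ) : ℂ) by simp, Complex.im_ofReal_mul]
  ring

/-- The exponent of a Gaussian wave packet damped in phase space. -/
noncomputable def dampedExponent (A : Matrix (Fin n) (Fin n) ℂ) (ε : ℝ)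
    (p : PhaseSpace n × EuclideanSpace ℝ (Fin n)) : ℂ :=
  Complex.I * packetPhase A p.1 p.2 -
    ε * (ofRealVec p.1.1 ⬝ᵥ ofRealVec p.1.1 + ofRealVec p.1.2 ⬝ᵥ ofRealVec p.1.2)

theorem dampedExponent_temperate (A : Matrix (Fin n) (Fin n) ℂ) (ε : ℝ) :
    (dampedExponent A ε).HasTemperateGrowth := by
  let L1 : PhaseSpace n × EuclideanSpace ℝ (Fin n) →L[ℝ] EuclideanSpace ℝ (Fin n) :=
    (ContinuousLinearMap.fst ℝ _ _).comp (ContinuousLinearMap.fst ℝ _ _)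
  let L2 : PhaseSpace n × EuclideanSpace ℝ (Fin n) →L[ℝ] EuclideanSpace ℝ (Fin n) :=
    (ContinuousLinearMap.snd ℝ _ _).comp (ContinuousLinearMap.fst ℝ _ _)
  let L3 : PhaseSpace n × EuclideanSpace ℝ (Fin n) →L[ℝ] EuclideanSpace ℝ (Fin n) :=
    ContinuousLinearMap.snd ℝ _ _
  have h1 := temperate_bil A (L3 - L1) (L3 - L1)
  have h2 := temperate_dotProduct L2 L3
  have h3 := temperate_dotProduct L1 L1
  have h4 := temperate_dotProduct L2 L2
  have h : dampedExponent A ε = fun p => Complex.I * (1 / 2 * bil A (ofRealVec ((L3 - L1) p))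
      (ofRealVec ((L3 - L1) p)) + ofRealVec (L2 p) ⬝ᵥ ofRealVec (L3 p)) -
      ε * (ofRealVec (L1 p) ⬝ᵥ ofRealVec (L1 p) + ofRealVec (L2 p) ⬝ᵥ ofRealVec (L2 p)) := rfl
  rw [h]
  fun_prop

theorem dampedExponent_bound {A : Matrix (Fin n) (Fin n) ℂ} (hA : (A.map Complex.im).PosDef)
    {ε : ℝ} (hε : 0 < ε) : ∃ B M c : ℝ, 0 < c ∧ ∀ p,
      (dampedExponent A ε p).re ≤ B + M * ‖p‖ - c * ‖p‖ ^ 2 := by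
  obtain ⟨c, hc, h⟩ := exists_le_bil_im hA
  -- Since ‖y‖² ≤ 2‖y - q‖² + 2‖q‖², these fractions keep d‖p‖² below the available decay (c/2)‖y -
  -- q‖² + ε(‖q‖² + ‖ξ‖²).
  let d := min (c / 4) (ε / 2)
  have hd : 0 < d := lt_min (by positivity) (by positivity)
  have hd1 : d ≤ c / 4 := min_le_left _ _
  have hd2 : d ≤ ε / 2 := min_le_right _ _
  refine ⟨0, 0, d, hd, fun ⟨⟨q, ξ⟩, y⟩ => ?_⟩
  have h1 : (dampedExponent A ε ((q, ξ), y)).re =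
      -(1 / 2) * (bil A (ofRealVec (y - q)) (ofRealVec (y - q))).im
        - ε * (‖q‖ ^ 2 + ‖ξ‖ ^ 2) := by
    rw [dampedExponent, Complex.sub_re, packetPhase_re]
    dsimp only
    rw [ofRealVec_dotProduct_self, ofRealVec_dotProduct_self, ← Complex.ofReal_add,
      ← Complex.ofReal_mul, Complex.ofReal_re]
  have h2 := h (y - q)
  have h3 : ‖y‖ ≤ ‖y - q‖ + ‖q‖ := by simpa using norm_add_le (y - q) q
  have h4 : ‖((q, ξ), y)‖ ^ 2 ≤ max (max (‖q‖ ^ 2) (‖ξ‖ ^ 2)) (‖y‖ ^ 2) := by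
    rw [Prod.norm_def, Prod.norm_def]
    rcases max_choice (max ‖q‖ ‖ξ‖) ‖y‖ with h | h
    · dsimp only
      rw [h]
      rcases max_choice ‖q‖ ‖ξ‖ with h' | h' <;> rw [h'] <;> simp
    · simp [h]
  have h5 : ‖y‖ ^ 2 ≤ 2 * ‖y - q‖ ^ 2 + 2 * ‖q‖ ^ 2 := by
    nlinarith [norm_nonneg y, norm_nonneg (y - q), norm_nonneg q, sq_nonneg (‖y - q‖ - ‖q‖)]
  have h6 : ‖((q, ξ), y)‖ ^ 2 ≤ 2 * ‖y - q‖ ^ 2 + 2 * ‖q‖ ^ 2 + ‖ξ‖ ^ 2 := by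
    refine h4.trans (max_le (max_le ?_ ?_) ?_) <;>
      nlinarith [sq_nonneg ‖y - q‖, sq_nonneg ‖q‖, sq_nonneg ‖ξ‖]
  rw [h1]
  have h7 : d * ‖((q, ξ), y)‖ ^ 2 ≤ c / 4 * (2 * ‖y - q‖ ^ 2) + ε / 2 * (2 * ‖q‖ ^ 2)
      + ε / 2 * ‖ξ‖ ^ 2 := by
    calc d * ‖((q, ξ), y)‖ ^ 2 ≤ d * (2 * ‖y - q‖ ^ 2 + 2 * ‖q‖ ^ 2 + ‖ξ‖ ^ 2) := by gcongr
      _ = d * (2 * ‖y - q‖ ^ 2) + d * (2 * ‖q‖ ^ 2) + d * ‖ξ‖ ^ 2 := by ring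
      _ ≤ _ := by gcongr
  nlinarith [sq_nonneg ‖ξ‖]

/-- The damped family of Gaussian wave packets, as a Schwartz function of all variables. -/
noncomputable def dampedPacket {A : Matrix (Fin n) (Fin n) ℂ} (hA : (A.map Complex.im).PosDef)
    {ε : ℝ} (hε : 0 < ε) : 𝓢(PhaseSpace n × EuclideanSpace ℝ (Fin n), ℂ) :=
  expSchwartz (dampedExponent A ε) (dampedExponent_temperate A ε) (dampedExponent_bound hA hε)

/-- The squared Euclidean norm on phase space. -/
noncomputable def normSqPS (a : PhaseSpace n) : ℝ := ‖a.1‖ ^ 2 + ‖a.2‖ ^ 2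

theorem continuous_normSqPS : Continuous (normSqPS (n := n)) := by
  unfold normSqPS
  fun_prop

theorem dampedExponent_eq (A : Matrix (Fin n) (Fin n) ℂ) (ε : ℝ) (a : PhaseSpace n)
    (y : EuclideanSpace ℝ (Fin n)) :
    dampedExponent A ε (a, y) = Complex.I * packetPhase A a y - (ε * normSqPS a : ℝ) := by
  simp [dampedExponent, ofRealVec_dotProduct_self, normSqPS]

/-- The Gaussian wave packet `y ↦ exp(i/2 A(y - q)·(y - q) + i ξ·y)`. -/
noncomputable def wavePacket {A : Matrix (Fin n) (Fin n) ℂ} (hA : (A.map Complex.im).PosDef)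
    (a : PhaseSpace n) : 𝓢(EuclideanSpace ℝ (Fin n), ℂ) :=
  Complex.exp (normSqPS a : ℂ) • slice (dampedPacket hA one_pos) a

theorem wavePacket_apply {A : Matrix (Fin n) (Fin n) ℂ} (hA : (A.map Complex.im).PosDef)
    (a : PhaseSpace n) (y : EuclideanSpace ℝ (Fin n)) :
    wavePacket hA a y = Complex.exp (Complex.I * packetPhase A a y) := by
  change Complex.exp (normSqPS a : ℂ) * Complex.exp (dampedExponent A 1 (a, y)) = _
  rw [dampedExponent_eq, ← Complex.exp_add]
  congr 1
  push_cast
  ring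

theorem continuous_wavePacket {A : Matrix (Fin n) (Fin n) ℂ} (hA : (A.map Complex.im).PosDef) :
    Continuous (wavePacket hA) :=
  (Complex.continuous_exp.comp (Complex.continuous_ofReal.comp continuous_normSqPS)).smul
    (continuous_slice _)

/-- The damping rate 1 in the definition is immaterial. Slices of the damped packet have seminorms
bounded uniformly in a, so the growth in a is at most that of the factor undoing the damping, and
its rate can be made arbitrarily small. -/
theorem wavePacket_eq {A : Matrix (Fin n) (Fin n) ℂ} (hA : (A.map Complex.im).PosDef)
    {ε : ℝ} (hε : 0 < ε) (a : PhaseSpace n) :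
    wavePacket hA a = Complex.exp ((ε * normSqPS a : ℝ) : ℂ) • slice (dampedPacket hA hε) a := by
  ext y
  rw [wavePacket_apply]
  change _ = Complex.exp ((ε * normSqPS a : ℝ) : ℂ) * Complex.exp (dampedExponent A ε (a, y))
  rw [dampedExponent_eq, ← Complex.exp_add]
  congr 1
  ring

/-- Schwartz seminorms of wave packets grow more slowly than any Gaussian. -/
theorem seminorm_wavePacket_le {A : Matrix (Fin n) (Fin n) ℂ} (hA : (A.map Complex.im).PosDef)
    {ε : ℝ} (hε : 0 < ε) (k l : ℕ) : ∃ C : ℝ, 0 ≤ C ∧ ∀ a,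
      SchwartzMap.seminorm ℂ k l (wavePacket hA a) ≤ C * Real.exp (ε * normSqPS a) := by
  refine ⟨SchwartzMap.seminorm ℝ k l (dampedPacket hA hε), by positivity, fun a => ?_⟩
  rw [wavePacket_eq hA hε, map_smul_eq_mul, Complex.norm_exp, Complex.ofReal_re, mul_comm]
  gcongr
  exact seminorm_slice_le _ a k l

theorem integrable_exp_neg_normSqPS {ε : ℝ} (hε : 0 < ε) :
    Integrable (fun a : PhaseSpace n => Real.exp (-ε * normSqPS a)) := by
  have h1 : Integrable (fun q : EuclideanSpace ℝ (Fin n) => Real.exp (-ε * ‖q‖ ^ 2)) := by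
    have := (GaussianFourier.integrable_cexp_neg_mul_sq_norm_add (b := (ε : ℂ)) (by simpa) 0
      (0 : EuclideanSpace ℝ (Fin n))).norm
    refine this.congr (Filter.Eventually.of_forall fun q => ?_)
    simp [Complex.norm_exp, ← Complex.ofReal_pow]
  refine (h1.mul_prod h1).congr (Filter.Eventually.of_forall fun a => ?_)
  dsimp only
  rw [← Real.exp_add, normSqPS]
  ring_nf

end WavePacket

/-! ### The synthesis kernel and its decay -/

section GaussianSynthesis

variable {n : ℕ}

theorem integral_gaussian_linear {b : ℝ} (hb : 0 < b) (c : Fin n → ℂ) :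
    ∫ v : EuclideanSpace ℝ (Fin n), Complex.exp (-b * (ofRealVec v ⬝ᵥ ofRealVec v) +
      c ⬝ᵥ ofRealVec v) = (Real.pi / b) ^ (n / 2 : ℂ) * Complex.exp ((c ⬝ᵥ c) / (4 * b)) := by
  rw [← (PiLp.volume_preserving_toLp (Fin n)).integral_comp
    (MeasurableEquiv.toLp 2 _).measurableEmbedding]
  have h := GaussianFourier.integral_cexp_neg_mul_sum_add (b := (b : ℂ)) (by simpa) c
  rw [Fintype.card_fin] at h
  simpa only [ofRealVec, dotProduct, sq] using h

theorem gaussian_const_ne_zero {b : ℝ} (hb : 0 < b) : (Real.pi / b : ℂ) ^ (n / 2 : ℂ) ≠ 0 := by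
  rw [Ne, Complex.cpow_eq_zero_iff]
  rintro ⟨h, -⟩
  rw [← Complex.ofReal_div, Complex.ofReal_eq_zero] at h
  exact (div_pos Real.pi_pos hb).ne' h

theorem integrable_exp_neg_sq {b : ℝ} (hb : 0 < b) :
    Integrable (fun v : EuclideanSpace ℝ (Fin n) => Real.exp (-b * ‖v‖ ^ 2)) := by
  have := (GaussianFourier.integrable_cexp_neg_mul_sq_norm_add (b := (b : ℂ)) (by simpa) 0
    (0 : EuclideanSpace ℝ (Fin n))).norm
  refine this.congr (Filter.Eventually.of_forall fun q => ?_)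
  simp [Complex.norm_exp, ← Complex.ofReal_pow]

theorem integral_exp_neg_sq {b : ℝ} (hb : 0 < b) :
    ∫ v : EuclideanSpace ℝ (Fin n), Real.exp (-b * ‖v‖ ^ 2) = (Real.pi / b) ^ (n / 2 : ℝ) := by
  rw [GaussianFourier.integral_rexp_neg_mul_sq_norm hb, finrank_euclideanSpace_fin]

/-- For large s the term in D is a small perturbation. With M bounding D and G(s) = ∫
exp(-(s/2)‖t‖²) dt, the integral differs from G(s) by at most G(s - M) - G(s) = G(s)((s/(s -
M))^{n/2} - 1), which is less than G(s) once the ratio is below 2. -/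
theorem eventually_integral_ne_zero (D : Matrix (Fin n) (Fin n) ℂ) :
    ∀ᶠ s : ℝ in Filter.atTop, ∫ t : EuclideanSpace ℝ (Fin n),
      Complex.exp (-(s / 2) * (ofRealVec t ⬝ᵥ ofRealVec t) +
        Complex.I / 2 * bil D (ofRealVec t) (ofRealVec t)) ≠ 0 := by
  set M := bilBound D with hM
  have hlim : Filter.Tendsto (fun s : ℝ => (s / (s - M)) ^ (n / 2 : ℝ)) Filter.atTop (nhds 1) := by
    have h1 : Filter.Tendsto (fun s : ℝ => M / (s - M)) Filter.atTop (nhds 0) :=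
      Filter.Tendsto.div_atTop tendsto_const_nhds
        (Filter.tendsto_atTop_add_const_right _ (-M) Filter.tendsto_id)
    have h2 : Filter.Tendsto (fun s : ℝ => 1 + M / (s - M)) Filter.atTop (nhds 1) := by
      simpa using h1.const_add 1
    have h3 : Filter.Tendsto (fun s : ℝ => s / (s - M)) Filter.atTop (nhds 1) := by
      refine h2.congr' ?_
      filter_upwards [Filter.eventually_gt_atTop M] with s hs
      have : s - M ≠ 0 := (sub_pos.2 hs).ne'
      field_simp
      ring
    simpa using h3.rpow_const (p := (n / 2 : ℝ)) (Or.inl one_ne_zero)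
  filter_upwards [hlim.eventually_lt_const one_lt_two, Filter.eventually_gt_atTop M,
    Filter.eventually_gt_atTop 0] with s h2 hsM hs0 h0
  have hb1 : 0 < s / 2 := by positivity
  have hb2 : 0 < (s - M) / 2 := by linarith
  let f : EuclideanSpace ℝ (Fin n) → ℂ := fun t =>
    Complex.exp (-(s / 2) * (ofRealVec t ⬝ᵥ ofRealVec t) +
        Complex.I / 2 * bil D (ofRealVec t) (ofRealVec t))
  -- This is |e^w - 1| ≤ e^{|w|} - 1 with |w| ≤ (M/2)‖t‖².
  have hpt : ∀ t, ‖f t - (Real.exp (-(s / 2) * ‖t‖ ^ 2) : ℝ)‖ ≤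
      Real.exp (-((s - M) / 2) * ‖t‖ ^ 2) - Real.exp (-(s / 2) * ‖t‖ ^ 2) := by
    intro t
    set w := Complex.I / 2 * bil D (ofRealVec t) (ofRealVec t) with hw
    have hwn : ‖w‖ ≤ M / 2 * ‖t‖ ^ 2 := by
      rw [hw, norm_mul, norm_div, Complex.norm_I, Complex.norm_ofNat]
      have := norm_bil_le D t t
      nlinarith
    have h3 : ‖Complex.exp w - 1‖ ≤ Real.exp ‖w‖ - 1 := by
      simpa using Complex.norm_exp_sub_sum_le_exp_norm_sub_sum w 1
    have h4 : f t - (Real.exp (-(s / 2) * ‖t‖ ^ 2) : ℝ) =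
        (Real.exp (-(s / 2) * ‖t‖ ^ 2) : ℝ) * (Complex.exp w - 1) := by
      simp only [f]
      rw [Complex.exp_add, ← hw, ofRealVec_dotProduct_self, Complex.ofReal_exp]
      push_cast
      ring
    rw [h4, norm_mul, Complex.norm_real, Real.norm_of_nonneg (Real.exp_pos _).le]
    calc Real.exp (-(s / 2) * ‖t‖ ^ 2) * ‖Complex.exp w - 1‖
        ≤ Real.exp (-(s / 2) * ‖t‖ ^ 2) * (Real.exp (M / 2 * ‖t‖ ^ 2) - 1) := by
          gcongr
          exact h3.trans (by gcongr)
      _ = _ := by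
          rw [mul_sub, ← Real.exp_add, mul_one]
          ring_nf
  have hf : Continuous f := by
    simp only [f, bil_eq_sum, dotProduct, ofRealVec]
    fun_prop
  have hi1 := integrable_exp_neg_sq (n := n) hb1
  have hi2 := integrable_exp_neg_sq (n := n) hb2
  have hi1' : Integrable fun t : EuclideanSpace ℝ (Fin n) =>
    ((Real.exp (-(s / 2) * ‖t‖ ^ 2) : ℝ) : ℂ) := hi1.ofReal
  have hd : Integrable fun t => f t - (Real.exp (-(s / 2) * ‖t‖ ^ 2) : ℝ) :=
    (hi2.sub hi1).mono' (hf.sub (by fun_prop)).aestronglyMeasurable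
      (Filter.Eventually.of_forall hpt)
  have hfi : Integrable f := by
    refine (hd.add hi1').congr (Filter.Eventually.of_forall fun t => ?_)
    simp
  have h5 := norm_integral_le_of_norm_le (g := fun t : EuclideanSpace ℝ (Fin n) =>
    Real.exp (-((s - M) / 2) * ‖t‖ ^ 2) - Real.exp (-(s / 2) * ‖t‖ ^ 2)) (hi2.sub hi1)
    (Filter.Eventually.of_forall hpt)
  rw [integral_sub hfi hi1', integral_sub hi2 hi1, integral_exp_neg_sq hb1,
    integral_exp_neg_sq hb2] at h5
  change ∫ t, f t = 0 at h0
  rw [h0, zero_sub, norm_neg, integral_complex_ofReal, integral_exp_neg_sq hb1, Complex.norm_real,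
    Real.norm_of_nonneg (by positivity)] at h5
  have h7 : Real.pi / ((s - M) / 2) = Real.pi / (s / 2) * (s / (s - M)) := by
    have : s - M ≠ 0 := (sub_pos.2 hsM).ne'
    field_simp
  rw [h7, Real.mul_rpow (by positivity) (div_nonneg hs0.le (sub_pos.2 hsM).le)] at h5
  have h8 : 0 < (Real.pi / (s / 2)) ^ (n / 2 : ℝ) := by positivity
  nlinarith

/-- The exponent of the Gaussian kernel that synthesises `exp(i/2 B y·y + i ζ·y)` from Gaussian
wave packets. -/
noncomputable def kernelExponent (B : Matrix (Fin n) (Fin n) ℂ) (s : ℝ) (ζ : Fin n → ℂ)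
    (a : PhaseSpace n) : ℂ :=
  -(1 / 2) * (s * (ofRealVec a.1 ⬝ᵥ ofRealVec a.1) +
      Complex.I * bil B (ofRealVec a.1) (ofRealVec a.1)) -
    1 / (2 * s) * ((ofRealVec a.2 + (Complex.I * s) • ofRealVec a.1 - B.mulVec (ofRealVec a.1) - ζ)
      ⬝ᵥ (ofRealVec a.2 + (Complex.I * s) • ofRealVec a.1 - B.mulVec (ofRealVec a.1) - ζ))

/-- The linear dependence of the kernel exponent on the frequency variable. -/
noncomputable def kernelSlope (B : Matrix (Fin n) (Fin n) ℂ) (s : ℝ) (a : PhaseSpace n) :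
    Fin n → ℂ :=
  (1 / s : ℂ) • (ofRealVec a.2 + (Complex.I * s) • ofRealVec a.1 - B.mulVec (ofRealVec a.1))

/-- The dependence on ζ and a is coupled only through a term linear in each. Hence decay at ζ = 0
persists for every ζ with a smaller rate, and the ζ-dependence of the synthesis integral is that of
a Laplace transform. -/
theorem kernelExponent_eq (B : Matrix (Fin n) (Fin n) ℂ) (s : ℝ) (ζ : Fin n → ℂ)
    (a : PhaseSpace n) : kernelExponent B s ζ a =
      kernelExponent B s 0 a + ζ ⬝ᵥ kernelSlope B s a - 1 / (2 * s) * (ζ ⬝ᵥ ζ) := by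
  simp only [kernelExponent, kernelSlope, sub_zero]
  generalize ofRealVec a.2 + (Complex.I * s) • ofRealVec a.1 - B.mulVec (ofRealVec a.1) = w
  rw [dotProduct_sub, sub_dotProduct, sub_dotProduct, dotProduct_smul, dotProduct_comm w ζ,
    smul_eq_mul]
  ring

/-- The two terms ∓(s/2) q·q cancel. The decay in q that survives as s grows comes from Im B, the
other terms being either purely oscillating or of size 1/s. -/
theorem kernelExponent_zero {s : ℝ} (hs : s ≠ 0) {B : Matrix (Fin n) (Fin n) ℂ} (hB : B.IsSymm)
    (q ξ : EuclideanSpace ℝ (Fin n)) :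
    kernelExponent B s 0 (q, ξ) = Complex.I / 2 * bil B (ofRealVec q) (ofRealVec q) -
      1 / (2 * s) * (ofRealVec ξ ⬝ᵥ ofRealVec ξ) - Complex.I * (ofRealVec ξ ⬝ᵥ ofRealVec q) +
      1 / s * bil B (ofRealVec ξ) (ofRealVec q) -
      1 / (2 * s) * bil (B * B) (ofRealVec q) (ofRealVec q) := by
  have h1 : B.mulVec (ofRealVec q) ⬝ᵥ B.mulVec (ofRealVec q) =
      bil (B * B) (ofRealVec q) (ofRealVec q) := by
    rw [dotProduct_mulVec_eq_bil, bil_comm hB, bil, bil, Matrix.mulVec_mulVec]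
  have hs' : (s : ℂ) ≠ 0 := by exact_mod_cast hs
  simp only [kernelExponent, sub_zero, dotProduct_sub, sub_dotProduct, add_dotProduct,
    dotProduct_add, smul_dotProduct, dotProduct_smul, h1, smul_eq_mul]
  rw [mulVec_dotProduct_eq_bil, mulVec_dotProduct_eq_bil, dotProduct_mulVec_eq_bil,
    dotProduct_mulVec_eq_bil, dotProduct_comm (ofRealVec q) (ofRealVec ξ)]
  field_simp
  linear_combination (-(s : ℂ) * (ofRealVec q ⬝ᵥ ofRealVec q) * s) * Complex.I_sq

theorem exists_re_kernelExponent_le {B : Matrix (Fin n) (Fin n) ℂ} (hB : B.IsSymm)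
    (hB' : (B.map Complex.im).PosDef) : ∀ᶠ s : ℝ in Filter.atTop,
      ∃ ε : ℝ, 0 < ε ∧ ∀ a : PhaseSpace n, (kernelExponent B s 0 a).re ≤ -ε * normSqPS a := by
  obtain ⟨c, hc, h⟩ := exists_le_bil_im hB'
  set M := bilBound B
  set N := bilBound (B * B)
  have hM : 0 ≤ M := bilBound_nonneg B
  have hN : 0 ≤ N := bilBound_nonneg (B * B)
  filter_upwards [Filter.eventually_gt_atTop 0,
    Filter.eventually_ge_atTop ((M ^ 2 + N / 2) / (c / 4))] with s hs hs2
  rw [div_le_iff₀ (by positivity)] at hs2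
  -- Half of the main decay, (c/2)‖q‖² + ‖ξ‖²/(2s), is spent on the cross term and the B² term; the
  -- lower bound on s makes this possible.
  refine ⟨min (c / 4) (1 / (4 * s)), lt_min (by positivity) (by positivity), fun ⟨q, ξ⟩ => ?_⟩
  have h1 : (kernelExponent B s 0 (q, ξ)).re =
      -(1 / 2) * (bil B (ofRealVec q) (ofRealVec q)).im - 1 / (2 * s) * ‖ξ‖ ^ 2 +
      1 / s * (bil B (ofRealVec ξ) (ofRealVec q)).re -
      1 / (2 * s) * (bil (B * B) (ofRealVec q) (ofRealVec q)).re := by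
    have e1 : (1 / (2 * s) : ℂ) = ((1 / (2 * s) : ℝ) : ℂ) := by push_cast; rfl
    have e2 : (1 / s : ℂ) = ((1 / s : ℝ) : ℂ) := by push_cast; rfl
    have e3 : Complex.I / 2 = ((1 / 2 : ℝ) : ℂ) * Complex.I := by push_cast; ring
    rw [kernelExponent_zero hs.ne' hB, e1, e2, e3, ofRealVec_dotProduct_self]
    simp only [Complex.sub_re, Complex.add_re, Complex.re_ofReal_mul, mul_assoc,
      Complex.I_mul_re, ofRealVec_dotProduct_im, Complex.ofReal_re]
    ring
  have h2 := h q
  have h3 : (bil B (ofRealVec ξ) (ofRealVec q)).re ≤ M * ‖ξ‖ * ‖q‖ :=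
    (Complex.re_le_norm _).trans (norm_bil_le B ξ q)
  have h4 : -(bil (B * B) (ofRealVec q) (ofRealVec q)).re ≤ N * ‖q‖ * ‖q‖ :=
    (neg_le_abs _).trans ((Complex.abs_re_le_norm _).trans (norm_bil_le (B * B) q q))
  have h5 : M * ‖ξ‖ * ‖q‖ ≤ 1 / 4 * ‖ξ‖ ^ 2 + M ^ 2 * ‖q‖ ^ 2 := by
    nlinarith [sq_nonneg (1 / 2 * ‖ξ‖ - M * ‖q‖)]
  have h6 : 1 / s * (M ^ 2 + N / 2) ≤ c / 4 := by
    rw [one_div, inv_mul_le_iff₀ hs]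
    linarith
  have h7 : 1 / s * (bil B (ofRealVec ξ) (ofRealVec q)).re -
      1 / (2 * s) * (bil (B * B) (ofRealVec q) (ofRealVec q)).re ≤
      1 / (4 * s) * ‖ξ‖ ^ 2 + c / 4 * ‖q‖ ^ 2 := by
    calc 1 / s * (bil B (ofRealVec ξ) (ofRealVec q)).re -
          1 / (2 * s) * (bil (B * B) (ofRealVec q) (ofRealVec q)).re
        = 1 / s * ((bil B (ofRealVec ξ) (ofRealVec q)).re +
          1 / 2 * (-(bil (B * B) (ofRealVec q) (ofRealVec q)).re)) := by field_simp; ring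
      _ ≤ 1 / s * ((1 / 4 * ‖ξ‖ ^ 2 + M ^ 2 * ‖q‖ ^ 2) + 1 / 2 * (N * ‖q‖ * ‖q‖)) := by
          gcongr
          exact h3.trans h5
      _ = 1 / (4 * s) * ‖ξ‖ ^ 2 + (1 / s * (M ^ 2 + N / 2)) * ‖q‖ ^ 2 := by field_simp; ring
      _ ≤ _ := by gcongr
  have h8 : min (c / 4) (1 / (4 * s)) * normSqPS (q, ξ) ≤
      c / 4 * ‖q‖ ^ 2 + 1 / (4 * s) * ‖ξ‖ ^ 2 := by
    rw [normSqPS, mul_add]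
    gcongr
    · exact min_le_left _ _
    · exact min_le_right _ _
  have h9 : 1 / (2 * s) * ‖ξ‖ ^ 2 = 2 * (1 / (4 * s) * ‖ξ‖ ^ 2) := by field_simp; ring
  rw [h1]
  linarith

/-- Covariance under phase space translations: moving the centre to a₀ changes the short-time
Fourier transform only by a shift, a phase, and the factor relating a wave packet to its plane
Gaussian. This turns the synthesis formula into a convolution bound. -/
theorem re_kernelExponent_shift {s : ℝ} (hs : s ≠ 0) {B : Matrix (Fin n) (Fin n) ℂ}
    (hB : B.IsSymm) (a a₀ : PhaseSpace n) :
    (kernelExponent B s (ofRealVec a₀.2 - B.mulVec (ofRealVec a₀.1)) a).re =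
      1 / 2 * (bil B (ofRealVec a₀.1) (ofRealVec a₀.1)).im +
        (kernelExponent B s 0 (a - a₀)).re := by
  obtain ⟨r, b, rfl⟩ : ∃ r b, a = (a₀.1 + r, a₀.2 + b) :=
    ⟨a.1 - a₀.1, a.2 - a₀.2, by simp⟩
  obtain ⟨q, ξ⟩ := a₀
  have hs' : (s : ℂ) ≠ 0 := by exact_mod_cast hs
  have h1 : ((q + r, ξ + b) : PhaseSpace n) - (q, ξ) = (r, b) := by simp
  have h2 : kernelExponent B s (ofRealVec ξ - B.mulVec (ofRealVec q)) (q + r, ξ + b) =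
      kernelExponent B s 0 (r, b) - Complex.I * (ofRealVec q ⬝ᵥ ofRealVec b) -
        ((1 / 2 : ℝ) : ℂ) * (Complex.I * bil B (ofRealVec q) (ofRealVec q)) := by
    have h3 : ofRealVec (ξ + b) + (Complex.I * s) • ofRealVec (q + r) -
        B.mulVec (ofRealVec (q + r)) - (ofRealVec ξ - B.mulVec (ofRealVec q)) =
        (ofRealVec b + (Complex.I * s) • ofRealVec r - B.mulVec (ofRealVec r)) +
          (Complex.I * s) • ofRealVec q := by
      rw [ofRealVec_add, ofRealVec_add, Matrix.mulVec_add, smul_add]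
      abel
    simp only [kernelExponent]
    rw [h3, sub_zero]
    set w := ofRealVec b + (Complex.I * s) • ofRealVec r - B.mulVec (ofRealVec r) with hw
    have h4 : ofRealVec q ⬝ᵥ w = ofRealVec q ⬝ᵥ ofRealVec b + Complex.I * s *
        (ofRealVec q ⬝ᵥ ofRealVec r) - bil B (ofRealVec q) (ofRealVec r) := by
      rw [hw, dotProduct_sub, dotProduct_add, dotProduct_smul, smul_eq_mul]
      rfl
    simp only [ofRealVec_add, bil_add_left, bil_add_right, dotProduct_add, add_dotProduct,
      smul_dotProduct, dotProduct_smul, smul_eq_mul, dotProduct_comm w (ofRealVec q), h4,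
      bil_comm hB (ofRealVec r) (ofRealVec q), dotProduct_comm (ofRealVec r) (ofRealVec q)]
    push_cast
    field_simp
    ring_nf
    simp only [Complex.I_sq]
    ring
  rw [h1]
  dsimp only
  rw [h2]
  simp only [Complex.sub_re, Complex.re_ofReal_mul, Complex.I_mul_re, ofRealVec_dotProduct_im]
  ring

end GaussianSynthesis

/-! ### Young's inequality with constant uniform in p -/

section Young

variable {G : Type} [MeasurableSpace G] {μ : Measure G}

/-- Comparison of the L¹ and L^p norms of f for the measure k μ, whose total mass is ∫ k. -/
theorem lintegral_mul_rpow_le {k f : G → ℝ≥0∞} (hk : Measurable k) (hf : Measurable f) {p : ℝ}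
    (hp : 1 ≤ p) :
    (∫⁻ b, k b * f b ∂μ) ^ p ≤ (∫⁻ b, k b ∂μ) ^ (p - 1) * ∫⁻ b, k b * f b ^ p ∂μ := by
  have h := eLpNorm'_le_eLpNorm'_mul_rpow_measure_univ (μ := μ.withDensity k) (f := f) one_pos hp
    hf.aestronglyMeasurable
  simp only [eLpNorm'_eq_lintegral_enorm, enorm_eq_self, ENNReal.rpow_one, div_one, one_div] at h
  rw [withDensity_apply _ MeasurableSet.univ, Measure.restrict_univ,
    lintegral_withDensity_eq_lintegral_mul _ hk hf,
    lintegral_withDensity_eq_lintegral_mul _ hk (hf.pow_const p)] at h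
  have hp0 : 0 < p := by linarith
  refine (ENNReal.rpow_le_rpow h hp0.le).trans_eq ?_
  rw [ENNReal.mul_rpow_of_nonneg _ _ hp0.le, ← ENNReal.rpow_mul, ← ENNReal.rpow_mul,
    inv_mul_cancel₀ hp0.ne', ENNReal.rpow_one, mul_comm]
  congr 2
  field_simp

variable [AddGroup G] [MeasurableAdd₂ G] [SFinite μ] [μ.IsAddLeftInvariant]
  [μ.IsAddRightInvariant]

/-- Young's inequality for the `L^p` norm of a function dominated by a convolution with an
integrable kernel. -/
theorem eLpNorm_le_of_enorm_le_lintegral {k : G → ℝ≥0∞} (hk : Measurable k) {f g : G → ℂ}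
    (hf : Measurable f) (h : ∀ x, ‖g x‖ₑ ≤ ∫⁻ b, k b * ‖f (x + b)‖ₑ ∂μ) {p : ℝ≥0∞} (hp : 1 ≤ p) :
    eLpNorm g p μ ≤ (∫⁻ b, k b ∂μ) * eLpNorm f p μ := by
  rcases eq_or_ne p ⊤ with rfl | hp'
  · rw [eLpNorm_exponent_top, eLpNorm_exponent_top]
    refine eLpNormEssSup_le_of_ae_enorm_bound (Filter.Eventually.of_forall fun x => (h x).trans ?_)
    rw [← lintegral_mul_const _ hk]
    refine lintegral_mono_ae ?_
    have h1 : ∀ᵐ b ∂μ, ‖f b‖ₑ ≤ eLpNormEssSup f μ := enorm_ae_le_eLpNormEssSup f μ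
    filter_upwards [(measurePreserving_add_left μ x).quasiMeasurePreserving.ae h1] with b hb
    gcongr
  · have hp0 : p ≠ 0 := (zero_lt_one.trans_le hp).ne'
    have hpr : 1 ≤ p.toReal := by
      rw [← ENNReal.toReal_one]
      exact ENNReal.toReal_mono hp' hp
    have hpr0 : 0 < p.toReal := by linarith
    rw [eLpNorm_eq_lintegral_rpow_enorm_toReal hp0 hp',
      eLpNorm_eq_lintegral_rpow_enorm_toReal hp0 hp', one_div,
      ENNReal.rpow_inv_le_iff hpr0, ENNReal.mul_rpow_of_nonneg _ _ hpr0.le, ← ENNReal.rpow_mul,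
      inv_mul_cancel₀ hpr0.ne', ENNReal.rpow_one]
    have hfm : Measurable fun z : G × G => k z.2 * ‖f (z.1 + z.2)‖ₑ ^ p.toReal :=
      (hk.comp measurable_snd).mul ((hf.comp measurable_add).enorm.pow_const _)
    -- Apply the previous inequality pointwise, exchange the integrals, and use right translation
    -- invariance in x; the powers p - 1 and 1 of ∫ k combine to p.
    calc ∫⁻ x, ‖g x‖ₑ ^ p.toReal ∂μ
        ≤ ∫⁻ x, (∫⁻ b, k b ∂μ) ^ (p.toReal - 1) * ∫⁻ b, k b * ‖f (x + b)‖ₑ ^ p.toReal ∂μ ∂μ := by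
          refine lintegral_mono fun x => ?_
          exact (ENNReal.rpow_le_rpow (h x) hpr0.le).trans
            (lintegral_mul_rpow_le hk (hf.comp (measurable_const_add x)).enorm hpr)
      _ = (∫⁻ b, k b ∂μ) ^ (p.toReal - 1) *
            ∫⁻ b, ∫⁻ x, k b * ‖f (x + b)‖ₑ ^ p.toReal ∂μ ∂μ := by
          rw [lintegral_const_mul _ hfm.lintegral_prod_right', lintegral_lintegral_swap]
          exact hfm.aemeasurable
      _ = (∫⁻ b, k b ∂μ) ^ (p.toReal - 1) * ((∫⁻ b, k b ∂μ) * ∫⁻ x, ‖f x‖ₑ ^ p.toReal ∂μ) := by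
          congr 1
          rw [← lintegral_mul_const _ hk]
          refine lintegral_congr fun b => ?_
          have hm : Measurable fun x => ‖f (x + b)‖ₑ ^ p.toReal :=
            (hf.comp (measurable_add_const b)).enorm.pow_const _
          rw [lintegral_const_mul _ hm, lintegral_add_right_eq_self (fun x => ‖f x‖ₑ ^ p.toReal) b]
      _ = (∫⁻ b, k b ∂μ) ^ p.toReal * ∫⁻ x, ‖f x‖ₑ ^ p.toReal ∂μ := by
          rw [← mul_assoc]
          congr 1
          nth_rewrite 2 [← ENNReal.rpow_one (∫⁻ b, k b ∂μ)]
          rw [← ENNReal.rpow_add_of_nonneg _ _ (by linarith) zero_le_one, sub_add_cancel]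

end Young

/-! ### Holomorphy of Laplace integrals with Gaussian decay -/

section LaplaceIntegral

variable {n : ℕ}

theorem norm_dotProduct_le (z w : Fin n → ℂ) : ‖z ⬝ᵥ w‖ ≤ n * ‖z‖ * ‖w‖ := by
  refine (norm_sum_le _ _).trans ?_
  calc ∑ j, ‖z j * w j‖ ≤ ∑ _j : Fin n, ‖z‖ * ‖w‖ := by
        refine Finset.sum_le_sum fun j _ => ?_
        rw [norm_mul]
        gcongr <;> exact norm_le_pi_norm _ j
    _ = n * ‖z‖ * ‖w‖ := by simp [mul_assoc]

/-- The complex linear form `z ↦ z · w`. -/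
noncomputable def dotCLM (w : Fin n → ℂ) : (Fin n → ℂ) →L[ℂ] ℂ :=
  ∑ j, w j • ContinuousLinearMap.proj (R := ℂ) (φ := fun _ : Fin n => ℂ) j

theorem dotCLM_apply (w z : Fin n → ℂ) : dotCLM w z = z ⬝ᵥ w := by
  simp [dotCLM, dotProduct, mul_comm]

theorem continuous_dotCLM : Continuous (dotCLM (n := n)) := by
  unfold dotCLM
  fun_prop

theorem norm_dotCLM_le (w : Fin n → ℂ) : ‖dotCLM w‖ ≤ n * ‖w‖ := by
  refine ContinuousLinearMap.opNorm_le_bound _ (by positivity) fun z => ?_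
  rw [dotCLM_apply]
  exact (norm_dotProduct_le z w).trans_eq (by ring)

theorem sq_norm_le_normSqPS (a : PhaseSpace n) : ‖a‖ ^ 2 ≤ normSqPS a := by
  rw [Prod.norm_def, normSqPS]
  rcases max_choice ‖a.1‖ ‖a.2‖ with h | h <;> rw [h]
  · linarith [sq_nonneg ‖a.2‖]
  · linarith [sq_nonneg ‖a.1‖]

theorem exp_mul_norm_le {R δ : ℝ} (hδ : 0 < δ) (a : PhaseSpace n) :
    Real.exp (R * ‖a‖) ≤ Real.exp (R ^ 2 / (4 * δ)) * Real.exp (δ * normSqPS a) := by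
  rw [← Real.exp_add]
  apply Real.exp_le_exp.2
  have h1 : R * ‖a‖ ≤ R ^ 2 / (4 * δ) + δ * ‖a‖ ^ 2 := by
    rw [← sub_nonneg]
    have : R ^ 2 / (4 * δ) + δ * ‖a‖ ^ 2 - R * ‖a‖ = (R - 2 * δ * ‖a‖) ^ 2 / (4 * δ) := by
      field_simp
      ring
    rw [this]
    positivity
  have := sq_norm_le_normSqPS a
  nlinarith

/-- The Laplace transform of a function with Gaussian decay is entire. -/
theorem differentiable_laplace {g : PhaseSpace n → ℂ} (hg : Continuous g) {C δ : ℝ} (hδ : 0 < δ)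
    (hC : 0 ≤ C) (hgb : ∀ a, ‖g a‖ ≤ C * Real.exp (-δ * normSqPS a))
    {m : PhaseSpace n → Fin n → ℂ} (hm : Continuous m) {L : ℝ} (hL : 0 ≤ L)
    (hmb : ∀ a, ‖m a‖ ≤ L * ‖a‖) :
    Differentiable ℂ fun ζ => ∫ a, g a * Complex.exp (ζ ⬝ᵥ m a) := by
  intro ζ₀
  set R : ℝ := ‖ζ₀‖ + 1 with hR
  set T : ℝ := n * R * L with hT
  have hT0 : 0 ≤ T := by positivity
  have hFc : ∀ ζ, Continuous fun a => g a * Complex.exp (ζ ⬝ᵥ m a) := by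
    intro ζ
    simp only [dotProduct]
    fun_prop
  have hexp : ∀ ζ ∈ Metric.ball ζ₀ 1, ∀ a, ‖Complex.exp (ζ ⬝ᵥ m a)‖ ≤ Real.exp (T * ‖a‖) := by
    intro ζ hζ a
    rw [Complex.norm_exp]
    apply Real.exp_le_exp.2
    have h1 : ‖ζ‖ ≤ R := by
      have := norm_lt_of_mem_ball hζ
      linarith
    calc (ζ ⬝ᵥ m a).re ≤ ‖ζ ⬝ᵥ m a‖ := Complex.re_le_norm _
      _ ≤ n * ‖ζ‖ * ‖m a‖ := norm_dotProduct_le _ _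
      _ ≤ n * R * (L * ‖a‖) := by
        gcongr
        exact hmb a
      _ = T * ‖a‖ := by rw [hT]; ring
  -- Differentiation in ζ brings down a factor of size ‖a‖ ≤ e^{‖a‖}, which raises the exponential
  -- rate from T to T + 1; half of the Gaussian decay absorbs it.
  let bound : PhaseSpace n → ℝ := fun a => C * n * L *
    Real.exp ((T + 1) ^ 2 / (4 * (δ / 2))) * Real.exp (-(δ / 2) * normSqPS a)
  have hbi : Integrable bound := (integrable_exp_neg_normSqPS (half_pos hδ)).const_mul _
  have hF'b : ∀ ζ ∈ Metric.ball ζ₀ 1, ∀ a,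
      ‖(g a * Complex.exp (ζ ⬝ᵥ m a)) • dotCLM (m a)‖ ≤ bound a := by
    intro ζ hζ a
    have h1 : ‖a‖ ≤ Real.exp ‖a‖ := by linarith [Real.add_one_le_exp ‖a‖]
    have h2 := exp_mul_norm_le (R := T + 1) (half_pos hδ) a
    rw [norm_smul, norm_mul]
    calc ‖g a‖ * ‖Complex.exp (ζ ⬝ᵥ m a)‖ * ‖dotCLM (m a)‖
        ≤ (C * Real.exp (-δ * normSqPS a)) * Real.exp (T * ‖a‖) * (n * (L * Real.exp ‖a‖)) := by
          gcongr
          · exact hgb a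
          · exact hexp ζ hζ a
          · refine (norm_dotCLM_le _).trans ?_
            gcongr
            exact (hmb a).trans (by gcongr)
      _ = C * n * L * (Real.exp (-δ * normSqPS a) * Real.exp ((T + 1) * ‖a‖)) := by
          rw [add_mul, one_mul, Real.exp_add]
          ring
      _ ≤ C * n * L * (Real.exp (-δ * normSqPS a) *
            (Real.exp ((T + 1) ^ 2 / (4 * (δ / 2))) * Real.exp (δ / 2 * normSqPS a))) := by
          gcongr
      _ = C * n * L * Real.exp ((T + 1) ^ 2 / (4 * (δ / 2))) *
            (Real.exp (-δ * normSqPS a) * Real.exp (δ / 2 * normSqPS a)) := by ring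
      _ = bound a := by
          rw [← Real.exp_add]
          simp only [bound]
          ring_nf
  have hFi : Integrable fun a => g a * Complex.exp (ζ₀ ⬝ᵥ m a) := by
    refine ((integrable_exp_neg_normSqPS (n := n) (half_pos hδ)).const_mul
      (C * Real.exp (T ^ 2 / (4 * (δ / 2))))).mono' (hFc ζ₀).aestronglyMeasurable
      (Filter.Eventually.of_forall fun a => ?_)
    have h2 := exp_mul_norm_le (R := T) (half_pos hδ) a
    rw [norm_mul]
    calc ‖g a‖ * ‖Complex.exp (ζ₀ ⬝ᵥ m a)‖
        ≤ (C * Real.exp (-δ * normSqPS a)) *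
          (Real.exp (T ^ 2 / (4 * (δ / 2))) * Real.exp (δ / 2 * normSqPS a)) := by
          gcongr
          · exact hgb a
          · exact (hexp ζ₀ (Metric.mem_ball_self one_pos) a).trans h2
      _ = C * Real.exp (T ^ 2 / (4 * (δ / 2))) *
            (Real.exp (-δ * normSqPS a) * Real.exp (δ / 2 * normSqPS a)) := by ring
      _ = _ := by
          rw [← Real.exp_add]
          ring_nf
  exact (hasFDerivAt_integral_of_dominated_of_fderiv_le (μ := volume) (𝕜 := ℂ)
    (F := fun ζ a => g a * Complex.exp (ζ ⬝ᵥ m a))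
    (F' := fun ζ a => (g a * Complex.exp (ζ ⬝ᵥ m a)) • dotCLM (m a)) (bound := bound)
    (Metric.ball_mem_nhds ζ₀ one_pos)
    (Filter.Eventually.of_forall fun ζ => (hFc ζ).aestronglyMeasurable) hFi
    ((hFc ζ₀).smul (continuous_dotCLM.comp hm)).aestronglyMeasurable
    (Filter.Eventually.of_forall fun a ζ hζ => hF'b ζ hζ a) hbi
    (Filter.Eventually.of_forall fun a ζ _ => by
      have h1 : HasFDerivAt (fun ζ : Fin n → ℂ => ζ ⬝ᵥ m a) (dotCLM (m a)) ζ := by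
        simp only [← dotCLM_apply]
        exact (dotCLM (m a)).hasFDerivAt
      have h2 := h1.cexp.const_mul (g a)
      rwa [smul_smul] at h2)).differentiableAt

end LaplaceIntegral

/-! ### Plane Gaussians as superpositions of wave packets -/

section PlaneGaussian

variable {n : ℕ}

/-- The exponent of `exp(i/2 B y·y + i ζ·y)`. -/
noncomputable def planeExponent (B : Matrix (Fin n) (Fin n) ℂ) (ζ : Fin n → ℂ)
    (y : EuclideanSpace ℝ (Fin n)) : ℂ :=
  Complex.I / 2 * bil B (ofRealVec y) (ofRealVec y) + Complex.I * (ζ ⬝ᵥ ofRealVec y)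

theorem planeExponent_temperate (B : Matrix (Fin n) (Fin n) ℂ) (ζ : Fin n → ℂ) :
    (planeExponent B ζ).HasTemperateGrowth := by
  have h1 := temperate_bil B (ContinuousLinearMap.id ℝ (EuclideanSpace ℝ (Fin n)))
    (ContinuousLinearMap.id ℝ (EuclideanSpace ℝ (Fin n)))
  have h2 := temperate_ofRealVec_apply (ContinuousLinearMap.id ℝ (EuclideanSpace ℝ (Fin n)))
  simp only [ContinuousLinearMap.id_apply] at h1 h2
  unfold planeExponent
  simp only [dotProduct]
  fun_prop

theorem planeExponent_bound {B : Matrix (Fin n) (Fin n) ℂ} (hB : (B.map Complex.im).PosDef)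
    (ζ : Fin n → ℂ) : ∃ A M c : ℝ, 0 < c ∧ ∀ y,
      (planeExponent B ζ y).re ≤ A + M * ‖y‖ - c * ‖y‖ ^ 2 := by
  obtain ⟨c, hc, h⟩ := exists_le_bil_im hB
  refine ⟨0, ∑ j, ‖ζ j‖, c / 2, by positivity, fun y => ?_⟩
  have h1 : (planeExponent B ζ y).re = -(1 / 2) * (bil B (ofRealVec y) (ofRealVec y)).im +
      -(ζ ⬝ᵥ ofRealVec y).im := by
    have e3 : Complex.I / 2 = ((1 / 2 : ℝ) : ℂ) * Complex.I := by push_cast; ring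
    rw [planeExponent, e3, Complex.add_re, mul_assoc, Complex.re_ofReal_mul, Complex.I_mul_re,
      Complex.I_mul_re]
    ring
  have h2 : -(ζ ⬝ᵥ ofRealVec y).im ≤ (∑ j, ‖ζ j‖) * ‖y‖ := by
    refine (neg_le_abs _).trans ((Complex.abs_im_le_norm _).trans ((norm_sum_le _ _).trans ?_))
    rw [Finset.sum_mul]
    refine Finset.sum_le_sum fun j _ => ?_
    rw [norm_mul]
    exact mul_le_mul_of_nonneg_left (norm_ofRealVec_apply_le y j) (norm_nonneg _)
  rw [h1]
  linarith [h y]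

/-- The Schwartz function `y ↦ exp(i/2 B y·y + i ζ·y)`. -/
noncomputable def planeGaussian {B : Matrix (Fin n) (Fin n) ℂ} (hB : (B.map Complex.im).PosDef)
    (ζ : Fin n → ℂ) : 𝓢(EuclideanSpace ℝ (Fin n), ℂ) :=
  expSchwartz (planeExponent B ζ) (planeExponent_temperate B ζ) (planeExponent_bound hB ζ)

/-- Expanding the square shows that position and frequency enter only through the complex frequency
ξ - Bq, up to a factor independent of y. -/
theorem wavePacket_eq_planeGaussian {B : Matrix (Fin n) (Fin n) ℂ} (hBs : B.IsSymm)
    (hB : (B.map Complex.im).PosDef) (a : PhaseSpace n) :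
    wavePacket hB a = Complex.exp (Complex.I / 2 * bil B (ofRealVec a.1) (ofRealVec a.1)) •
      planeGaussian hB (ofRealVec a.2 - B.mulVec (ofRealVec a.1)) := by
  ext y
  change _ = Complex.exp _ * Complex.exp (planeExponent _ _ y)
  rw [wavePacket_apply, ← Complex.exp_add]
  congr 1
  simp only [packetPhase, planeExponent, ofRealVec_sub, bil_sub_left, bil_sub_right,
    sub_dotProduct, mulVec_dotProduct_eq_bil, bil_comm hBs (ofRealVec a.1) (ofRealVec y)]
  ring

theorem norm_kernelSlope_le (B : Matrix (Fin n) (Fin n) ℂ) (s : ℝ) :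
    ∃ L : ℝ, 0 ≤ L ∧ ∀ a, ‖kernelSlope B s a‖ ≤ L * ‖a‖ := by
  have hq : ∀ q : EuclideanSpace ℝ (Fin n), ‖ofRealVec q‖ ≤ ‖q‖ := fun q =>
    (pi_norm_le_iff_of_nonneg (norm_nonneg q)).2 fun j => norm_ofRealVec_apply_le q j
  let T : (Fin n → ℂ) →L[ℂ] (Fin n → ℂ) := LinearMap.toContinuousLinearMap B.mulVecLin
  refine ⟨‖(1 / s : ℂ)‖ * (1 + ‖Complex.I * s‖ + ‖T‖), by positivity, fun a => ?_⟩
  rw [kernelSlope, norm_smul, mul_assoc]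
  gcongr
  have h1 : ‖ofRealVec a.2‖ ≤ ‖a‖ := (hq _).trans (norm_snd_le a)
  have h2 : ‖ofRealVec a.1‖ ≤ ‖a‖ := (hq _).trans (norm_fst_le a)
  have h3 : ‖B.mulVec (ofRealVec a.1)‖ ≤ ‖T‖ * ‖a‖ :=
    (T.le_opNorm (ofRealVec a.1)).trans (by gcongr)
  refine (norm_sub_le _ _).trans ?_
  have h4 : ‖(Complex.I * s) • ofRealVec a.1‖ ≤ ‖Complex.I * s‖ * ‖a‖ := by
    rw [norm_smul]
    gcongr
  linarith [norm_add_le (ofRealVec a.2) ((Complex.I * s) • ofRealVec a.1)]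

theorem continuous_ofRealVec : Continuous (ofRealVec (n := n)) := by
  unfold ofRealVec
  fun_prop

theorem continuous_kernelSlope (B : Matrix (Fin n) (Fin n) ℂ) (s : ℝ) :
    Continuous (kernelSlope B s) := by
  have := continuous_ofRealVec (n := n)
  unfold kernelSlope
  fun_prop

theorem continuous_kernelExponent (B : Matrix (Fin n) (Fin n) ℂ) (s : ℝ) (ζ : Fin n → ℂ) :
    Continuous (kernelExponent B s ζ) := by
  have h := continuous_ofRealVec (n := n)
  unfold kernelExponent bil
  fun_prop

/-- Gaussian decay of the synthesis kernel. -/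
theorem exists_norm_exp_kernelExponent_le {B : Matrix (Fin n) (Fin n) ℂ} {s ε : ℝ} (hε : 0 < ε)
    (h : ∀ a, (kernelExponent B s 0 a).re ≤ -ε * normSqPS a) (ζ : Fin n → ℂ) :
    ∃ C : ℝ, 0 ≤ C ∧ ∀ a,
      ‖Complex.exp (kernelExponent B s ζ a)‖ ≤ C * Real.exp (-(ε / 2) * normSqPS a) := by
  obtain ⟨L, hL, hL'⟩ := norm_kernelSlope_le B s
  set K : ℝ := ‖Complex.exp (-(1 / (2 * s) * (ζ ⬝ᵥ ζ)))‖
  set R : ℝ := n * ‖ζ‖ * L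
  refine ⟨K * Real.exp (R ^ 2 / (4 * (ε / 2))), by positivity, fun a => ?_⟩
  have h1 : ‖Complex.exp (ζ ⬝ᵥ kernelSlope B s a)‖ ≤ Real.exp (R * ‖a‖) := by
    rw [Complex.norm_exp]
    apply Real.exp_le_exp.2
    calc (ζ ⬝ᵥ kernelSlope B s a).re ≤ ‖ζ ⬝ᵥ kernelSlope B s a‖ := Complex.re_le_norm _
      _ ≤ n * ‖ζ‖ * ‖kernelSlope B s a‖ := norm_dotProduct_le _ _
      _ ≤ n * ‖ζ‖ * (L * ‖a‖) := by
        gcongr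
        exact hL' a
      _ = R * ‖a‖ := by ring
  have h2 := h1.trans (exp_mul_norm_le (half_pos hε) a)
  have h3 : ‖Complex.exp (kernelExponent B s 0 a)‖ ≤ Real.exp (-ε * normSqPS a) := by
    rw [Complex.norm_exp]
    exact Real.exp_le_exp.2 (h a)
  rw [kernelExponent_eq, sub_eq_add_neg, Complex.exp_add, Complex.exp_add, norm_mul, norm_mul]
  calc ‖Complex.exp (kernelExponent B s 0 a)‖ * ‖Complex.exp (ζ ⬝ᵥ kernelSlope B s a)‖ * K
      ≤ Real.exp (-ε * normSqPS a) *
        (Real.exp (R ^ 2 / (4 * (ε / 2))) * Real.exp (ε / 2 * normSqPS a)) * K := by gcongr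
    _ = K * Real.exp (R ^ 2 / (4 * (ε / 2))) *
        (Real.exp (-ε * normSqPS a) * Real.exp (ε / 2 * normSqPS a)) := by ring
    _ = _ := by
        rw [← Real.exp_add]
        ring_nf

variable {A B : Matrix (Fin n) (Fin n) ℂ}

/-- The family of wave packets weighted by the synthesis kernel. -/
noncomputable def weightedPacket (hA : (A.map Complex.im).PosDef) (B : Matrix (Fin n) (Fin n) ℂ)
    (s : ℝ) (ζ : Fin n → ℂ) (a : PhaseSpace n) : 𝓢(EuclideanSpace ℝ (Fin n), ℂ) :=
  Complex.exp (kernelExponent B s ζ a) • wavePacket hA a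

theorem continuous_weightedPacket (hA : (A.map Complex.im).PosDef)
    (B : Matrix (Fin n) (Fin n) ℂ) (s : ℝ) (ζ : Fin n → ℂ) :
    Continuous (weightedPacket hA B s ζ) :=
  (Complex.continuous_exp.comp (continuous_kernelExponent B s ζ)).smul (continuous_wavePacket hA)

theorem integrable_seminorm_weightedPacket (hA : (A.map Complex.im).PosDef) {s ε : ℝ}
    (hε : 0 < ε) (h : ∀ a, (kernelExponent B s 0 a).re ≤ -ε * normSqPS a) (ζ : Fin n → ℂ)
    (k l : ℕ) :
    Integrable fun a => SchwartzMap.seminorm ℂ k l (weightedPacket hA B s ζ a) := by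
  obtain ⟨C, hC, hC'⟩ := exists_norm_exp_kernelExponent_le hε h ζ
  -- The kernel decays at rate ε/2; letting the packet seminorms grow at rate ε/4 leaves integrable
  -- decay at rate ε/4.
  have hε4 : 0 < ε / 4 := by positivity
  obtain ⟨D, hD, hD'⟩ := seminorm_wavePacket_le hA hε4 k l
  have hc : Continuous fun a => SchwartzMap.seminorm ℂ k l (weightedPacket hA B s ζ a) :=
    ((schwartz_withSeminorms ℂ _ ℂ).continuous_seminorm (k, l)).comp
      (continuous_weightedPacket hA B s ζ)
  refine ((integrable_exp_neg_normSqPS hε4).const_mul (C * D)).mono' hc.aestronglyMeasurable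
    (Filter.Eventually.of_forall fun a => ?_)
  rw [Real.norm_of_nonneg (by positivity), weightedPacket, map_smul_eq_mul]
  calc ‖Complex.exp (kernelExponent B s ζ a)‖ * SchwartzMap.seminorm ℂ k l (wavePacket hA a)
      ≤ (C * Real.exp (-(ε / 2) * normSqPS a)) * (D * Real.exp (ε / 4 * normSqPS a)) := by
        gcongr
        · exact hC' a
        · exact hD' a
    _ = C * D * (Real.exp (-(ε / 2) * normSqPS a) * Real.exp (ε / 4 * normSqPS a)) := by ring
    _ = _ := by
        rw [← Real.exp_add]
        ring_nf

/-- The exponent left after the Gaussian integral in ξ, which contributes (s/2) c·c. The terms w·w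
cancel, and what remains splits into a part free of q and a function of y - q alone. -/
theorem synthesis_exponent {s : ℝ} (hs : s ≠ 0) (hB : B.IsSymm) (ζ : Fin n → ℂ)
    (q y : EuclideanSpace ℝ (Fin n)) (c w : Fin n → ℂ)
    (hw : w = (Complex.I * s) • ofRealVec q - B.mulVec (ofRealVec q) - ζ)
    (hc : c = Complex.I • ofRealVec y - (1 / s : ℂ) • w) :
    -(1 / 2) * (s * (ofRealVec q ⬝ᵥ ofRealVec q) + Complex.I * bil B (ofRealVec q) (ofRealVec q))
      - 1 / (2 * s) * (w ⬝ᵥ w) +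
      Complex.I / 2 * bil A (ofRealVec (y - q)) (ofRealVec (y - q)) + (s / 2) * (c ⬝ᵥ c) =
    planeExponent B ζ y + (-(s / 2) * (ofRealVec (y - q) ⬝ᵥ ofRealVec (y - q)) +
      Complex.I / 2 * bil (A - B) (ofRealVec (y - q)) (ofRealVec (y - q))) := by
  have hs' : (s : ℂ) ≠ 0 := by exact_mod_cast hs
  have h1 : ofRealVec y ⬝ᵥ w = Complex.I * s * (ofRealVec y ⬝ᵥ ofRealVec q) -
      bil B (ofRealVec y) (ofRealVec q) - ζ ⬝ᵥ ofRealVec y := by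
    rw [hw, dotProduct_sub, dotProduct_sub, dotProduct_smul, smul_eq_mul, dotProduct_comm _ ζ]
    rfl
  have h2 : (s / 2) * (c ⬝ᵥ c) = -(s / 2) * (ofRealVec y ⬝ᵥ ofRealVec y) -
      Complex.I * (ofRealVec y ⬝ᵥ w) + 1 / (2 * s) * (w ⬝ᵥ w) := by
    rw [hc]
    simp only [dotProduct_sub, sub_dotProduct, dotProduct_smul, smul_dotProduct, smul_eq_mul,
      dotProduct_comm w (ofRealVec y)]
    field_simp
    linear_combination ((s : ℂ) ^ 2 * (ofRealVec y ⬝ᵥ ofRealVec y)) * Complex.I_sq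
  rw [h2, h1, bil_sub_matrix, planeExponent, ofRealVec_sub]
  simp only [bil_sub_left, bil_sub_right, dotProduct_sub, sub_dotProduct,
    bil_comm hB (ofRealVec q) (ofRealVec y), dotProduct_comm (ofRealVec q) (ofRealVec y)]
  linear_combination (-(s : ℂ) * (ofRealVec y ⬝ᵥ ofRealVec q)) * Complex.I_sq

/-- Plane Gaussians are superpositions of wave packets. -/
theorem integral_weightedPacket (hA : (A.map Complex.im).PosDef) (hB : B.IsSymm) {s ε : ℝ}
    (hs : 0 < s) (hε : 0 < ε) (h : ∀ a, (kernelExponent B s 0 a).re ≤ -ε * normSqPS a)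
    (ζ : Fin n → ℂ) (y : EuclideanSpace ℝ (Fin n)) :
    ∫ a, weightedPacket hA B s ζ a y =
      ((Real.pi / (1 / (2 * s) : ℝ)) ^ (n / 2 : ℂ) * ∫ t : EuclideanSpace ℝ (Fin n),
        Complex.exp (-(s / 2) * (ofRealVec t ⬝ᵥ ofRealVec t) +
          Complex.I / 2 * bil (A - B) (ofRealVec t) (ofRealVec t))) *
      Complex.exp (planeExponent B ζ y) := by
  have hint : Integrable fun a => weightedPacket hA B s ζ a y := by
    have hc : Continuous fun a => weightedPacket hA B s ζ a y := by
      have h1 : (fun a => weightedPacket hA B s ζ a y) = fun a =>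
          Complex.exp (kernelExponent B s ζ a) * Complex.exp (Complex.I * packetPhase A a y) := by
        funext a
        rw [← wavePacket_apply hA]
        rfl
      have h2 := continuous_kernelExponent B s ζ
      have h3 := continuous_ofRealVec (n := n)
      rw [h1]
      unfold packetPhase bil
      fun_prop
    refine (integrable_seminorm_weightedPacket hA hε h ζ 0 0).mono' hc.aestronglyMeasurable
      (Filter.Eventually.of_forall fun a => ?_)
    exact SchwartzMap.norm_le_seminorm ℂ _ y
  -- Integrating over ξ first is Fourier inversion for the windowed plane Gaussian. The result
  -- depends on q only through y - q, so the remaining integral over q is a constant independent of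
  -- y.
  have hinner : ∀ q : EuclideanSpace ℝ (Fin n),
      ∫ ξ : EuclideanSpace ℝ (Fin n), weightedPacket hA B s ζ (q, ξ) y =
      (Real.pi / (1 / (2 * s) : ℝ)) ^ (n / 2 : ℂ) * Complex.exp (planeExponent B ζ y) *
        Complex.exp (-(s / 2) * (ofRealVec (y - q) ⬝ᵥ ofRealVec (y - q)) +
          Complex.I / 2 * bil (A - B) (ofRealVec (y - q)) (ofRealVec (y - q))) := by
    intro q
    obtain ⟨w, hw⟩ : ∃ w, w = (Complex.I * s) • ofRealVec q - B.mulVec (ofRealVec q) - ζ :=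
      ⟨_, rfl⟩
    obtain ⟨c, hc⟩ : ∃ c, c = Complex.I • ofRealVec y - (1 / s : ℂ) • w := ⟨_, rfl⟩
    have hs' : (s : ℂ) ≠ 0 := by exact_mod_cast hs.ne'
    have hpt : ∀ ξ : EuclideanSpace ℝ (Fin n), weightedPacket hA B s ζ (q, ξ) y =
        Complex.exp (-(1 / 2) * (s * (ofRealVec q ⬝ᵥ ofRealVec q) +
          Complex.I * bil B (ofRealVec q) (ofRealVec q)) - 1 / (2 * s) * (w ⬝ᵥ w) +
          Complex.I / 2 * bil A (ofRealVec (y - q)) (ofRealVec (y - q))) *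
        Complex.exp (-(1 / (2 * s) : ℝ) * (ofRealVec ξ ⬝ᵥ ofRealVec ξ) + c ⬝ᵥ ofRealVec ξ) := by
      intro ξ
      change Complex.exp _ * wavePacket hA (q, ξ) y = _
      rw [wavePacket_apply, ← Complex.exp_add, ← Complex.exp_add]
      congr 1
      have h1 : ofRealVec ξ + (Complex.I * s) • ofRealVec q - B.mulVec (ofRealVec q) - ζ =
          ofRealVec ξ + w := by
        rw [hw]
        abel
      have h2 : c ⬝ᵥ ofRealVec ξ = Complex.I * (ofRealVec ξ ⬝ᵥ ofRealVec y) -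
          1 / s * (ofRealVec ξ ⬝ᵥ w) := by
        rw [hc, dotProduct_comm, dotProduct_sub, dotProduct_smul, dotProduct_smul]
        rfl
      simp only [kernelExponent, packetPhase]
      rw [h1, h2, dotProduct_add, add_dotProduct, add_dotProduct, dotProduct_comm w]
      push_cast
      ring
    simp only [hpt]
    rw [integral_const_mul, integral_gaussian_linear (by positivity), mul_left_comm, mul_assoc,
      ← Complex.exp_add, ← Complex.exp_add, ← synthesis_exponent hs.ne' hB ζ q y c w hw hc]
    congr 3
    push_cast
    field_simp
    ring
  rw [Measure.volume_eq_prod, integral_prod _ hint]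
  simp only [hinner]
  rw [integral_const_mul, integral_sub_left_eq_self (fun t : EuclideanSpace ℝ (Fin n) =>
    Complex.exp (-(s / 2) * (ofRealVec t ⬝ᵥ ofRealVec t) +
      Complex.I / 2 * bil (A - B) (ofRealVec t) (ofRealVec t)))]
  ring

end PlaneGaussian

/-! ### Comparison of two families of wave packets -/

section Comparison

variable {n : ℕ} {A B : Matrix (Fin n) (Fin n) ℂ}

theorem continuous_apply_wavePacket (hA : (A.map Complex.im).PosDef)
    (u : 𝓢'(EuclideanSpace ℝ (Fin n), ℂ)) : Continuous fun a => u (wavePacket hA a) :=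
  u.continuous.comp (continuous_wavePacket hA)

theorem norm_apply_wavePacket_le (hA : (A.map Complex.im).PosDef)
    (u : 𝓢'(EuclideanSpace ℝ (Fin n), ℂ)) {δ : ℝ} (hδ : 0 < δ) :
    ∃ C : ℝ, 0 ≤ C ∧ ∀ a, ‖u (wavePacket hA a)‖ ≤ C * Real.exp (δ * normSqPS a) := by
  obtain ⟨s, C, hC, hu⟩ := exists_norm_le_sum_seminorm (V := ℂ) u
  choose D hD hD' using seminorm_wavePacket_le hA hδ
  refine ⟨C * ∑ i ∈ s, D i.1 i.2, mul_nonneg hC (Finset.sum_nonneg fun i _ => hD i.1 i.2),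
    fun a => (hu (wavePacket hA a)).trans ?_⟩
  rw [mul_assoc, Finset.sum_mul]
  gcongr with i
  exact hD' _ _ a

instance : (volume : Measure (PhaseSpace n)).IsAddHaarMeasure := by
  rw [Measure.volume_eq_prod]
  infer_instance

/-- The action of a tempered distribution on plane Gaussians in terms of its action on wave
packets. -/
theorem exists_synthesis (hA : (A.map Complex.im).PosDef) (hBs : B.IsSymm)
    (hB : (B.map Complex.im).PosDef) :
    ∃ (s ε : ℝ) (c : ℂ), 0 < s ∧ 0 < ε ∧ c ≠ 0 ∧
      (∀ a, (kernelExponent B s 0 a).re ≤ -ε * normSqPS a) ∧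
      ∀ (u : 𝓢'(EuclideanSpace ℝ (Fin n), ℂ)) (ζ : Fin n → ℂ),
        c * u (planeGaussian hB ζ) =
          ∫ a, Complex.exp (kernelExponent B s ζ a) * u (wavePacket hA a) := by
  -- Taking s large secures at once a nonzero pairing of the windows and Gaussian decay of the
  -- kernel. The choice depends on A and B only, not on u or ζ.
  obtain ⟨s, hs, h0, ε, hε, h⟩ := ((Filter.eventually_gt_atTop 0).and
    ((eventually_integral_ne_zero (A - B)).and (exists_re_kernelExponent_le hBs hB))).exists
  refine ⟨s, ε, _, hs, hε, mul_ne_zero (gaussian_const_ne_zero (n := n)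
    (b := 1 / (2 * s)) (by positivity)) h0, h, fun u ζ => ?_⟩
  have h1 := (functional_integral_comm (V := ℂ) u (continuous_weightedPacket hA B s ζ)
    (integrable_seminorm_weightedPacket hA hε h ζ)
    (h := ((Real.pi / (1 / (2 * s) : ℝ)) ^ (n / 2 : ℂ) * ∫ t : EuclideanSpace ℝ (Fin n),
        Complex.exp (-(s / 2) * (ofRealVec t ⬝ᵥ ofRealVec t) +
          Complex.I / 2 * bil (A - B) (ofRealVec t) (ofRealVec t))) • planeGaussian hB ζ)
    (fun y => (integral_weightedPacket hA hBs hs hε h ζ y).symm)).2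
  refine (map_smul u _ _).symm.trans (h1.trans (integral_congr_ae
    (Filter.Eventually.of_forall fun a => ?_)))
  exact map_smul u _ _

/-- Synthesising the plane Gaussian from packets of the same matrix puts all of the ζ-dependence
into the explicit kernel. Holomorphy then follows from the Laplace integral, without differentiating
a map into the Schwartz space. -/
theorem differentiable_apply_planeGaussian (hBs : B.IsSymm) (hB : (B.map Complex.im).PosDef)
    (u : 𝓢'(EuclideanSpace ℝ (Fin n), ℂ)) :
    Differentiable ℂ fun ζ => u (planeGaussian hB ζ) := by
  obtain ⟨s, ε, c, hs, hε, hc, h, hu⟩ := exists_synthesis hB hBs hB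
  obtain ⟨C, hC, hC'⟩ := norm_apply_wavePacket_le hB u (half_pos hε)
  obtain ⟨L, hL, hL'⟩ := norm_kernelSlope_le B s
  have h1 := differentiable_laplace (g := fun a => Complex.exp (kernelExponent B s 0 a) *
    u (wavePacket hB a)) ((Complex.continuous_exp.comp (continuous_kernelExponent B s 0)).mul
      (continuous_apply_wavePacket hB u)) (half_pos hε) hC (fun a => by
        rw [norm_mul, Complex.norm_exp]
        calc Real.exp (kernelExponent B s 0 a).re * ‖u (wavePacket hB a)‖
            ≤ Real.exp (-ε * normSqPS a) * (C * Real.exp (ε / 2 * normSqPS a)) := by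
              gcongr
              · exact h a
              · exact hC' a
          _ = C * (Real.exp (-ε * normSqPS a) * Real.exp (ε / 2 * normSqPS a)) := by ring
          _ = _ := by
            rw [← Real.exp_add]
            ring_nf)
    (continuous_kernelSlope B s) hL hL'
  have h2 : Differentiable ℂ fun ζ : Fin n → ℂ => Complex.exp (-(1 / (2 * s) * (ζ ⬝ᵥ ζ))) := by
    simp only [dotProduct]
    fun_prop
  have h3 : (fun ζ => u (planeGaussian hB ζ)) = fun ζ => c⁻¹ *
      (Complex.exp (-(1 / (2 * s) * (ζ ⬝ᵥ ζ))) * ∫ a, Complex.exp (kernelExponent B s 0 a) *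
        u (wavePacket hB a) * Complex.exp (ζ ⬝ᵥ kernelSlope B s a)) := by
    funext ζ
    rw [eq_inv_mul_iff_mul_eq₀ hc, hu, ← integral_const_mul]
    refine integral_congr_ae (Filter.Eventually.of_forall fun a => ?_)
    dsimp only
    rw [kernelExponent_eq, sub_eq_add_neg, Complex.exp_add, Complex.exp_add]
    ring
  rw [h3]
  exact (h2.mul h1).const_mul _

/-- The action of a tempered distribution on one family of wave packets is dominated by a
convolution of its action on another family with a Gaussian. -/
theorem exists_enorm_apply_wavePacket_le (hA : (A.map Complex.im).PosDef) (hBs : B.IsSymm)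
    (hB : (B.map Complex.im).PosDef) :
    ∃ (ε D : ℝ), 0 < ε ∧ ∀ (u : 𝓢'(EuclideanSpace ℝ (Fin n), ℂ)) (a₀ : PhaseSpace n),
      ‖u (wavePacket hB a₀)‖ₑ ≤ ∫⁻ b, ENNReal.ofReal (D * Real.exp (-ε * normSqPS b)) *
        ‖u (wavePacket hA (a₀ + b))‖ₑ := by
  obtain ⟨s, ε, c, hs, hε, hc, h, hu⟩ := exists_synthesis hA hBs hB
  refine ⟨ε, ‖c⁻¹‖, hε, fun u a₀ => ?_⟩
  set ζ := ofRealVec a₀.2 - B.mulVec (ofRealVec a₀.1)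
  set r := Complex.exp (Complex.I / 2 * bil B (ofRealVec a₀.1) (ofRealVec a₀.1)) with hr
  have h1 : u (wavePacket hB a₀) = ∫ a, r * c⁻¹ * (Complex.exp (kernelExponent B s ζ a) *
      u (wavePacket hA a)) := by
    rw [integral_const_mul, ← hu, wavePacket_eq_planeGaussian hBs hB, mul_assoc,
      inv_mul_cancel_left₀ hc]
    exact map_smul u _ _
  rw [h1]
  refine (enorm_integral_le_lintegral_enorm _).trans ?_
  -- Recentre the integral at a₀, so that the kernel is evaluated at the displacement b.
  rw [← lintegral_add_left_eq_self _ a₀]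
  refine lintegral_mono fun b => ?_
  rw [← mul_assoc, enorm_mul]
  gcongr
  rw [← ofReal_norm]
  apply ENNReal.ofReal_le_ofReal
  have h2 : ‖r‖ = Real.exp (-(1 / 2 * (bil B (ofRealVec a₀.1) (ofRealVec a₀.1)).im)) := by
    have e3 : Complex.I / 2 = ((1 / 2 : ℝ) : ℂ) * Complex.I := by push_cast; ring
    rw [hr, Complex.norm_exp, e3, mul_assoc, Complex.re_ofReal_mul, Complex.I_mul_re]
    ring_nf
  -- The modulus of r cancels exactly the growing term 1/2 Im Bq₀·q₀ from the shift identity,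
  -- leaving a bound uniform in a₀.
  rw [norm_mul, norm_mul, h2, Complex.norm_exp, re_kernelExponent_shift hs.ne' hBs,
    add_sub_cancel_left, mul_right_comm, ← Real.exp_add, neg_add_cancel_left, mul_comm]
  gcongr
  exact h b

/-- Gaussian windows define equivalent norms. -/
theorem exists_eLpNorm_apply_wavePacket_le (hA : (A.map Complex.im).PosDef) (hBs : B.IsSymm)
    (hB : (B.map Complex.im).PosDef) :
    ∃ K : ℝ≥0, ∀ (p : ℝ≥0∞), 1 ≤ p → ∀ u : 𝓢'(EuclideanSpace ℝ (Fin n), ℂ),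
      eLpNorm (fun a => u (wavePacket hB a)) p volume ≤
        K * eLpNorm (fun a => u (wavePacket hA a)) p volume := by
  obtain ⟨ε, D, hε, h⟩ := exists_enorm_apply_wavePacket_le hA hBs hB
  have hfin : ∫⁻ b : PhaseSpace n, ENNReal.ofReal (D * Real.exp (-ε * normSqPS b)) ≠ ⊤ :=
    ((integrable_exp_neg_normSqPS hε).const_mul D).lintegral_lt_top.ne
  refine ⟨(∫⁻ b : PhaseSpace n, ENNReal.ofReal (D * Real.exp (-ε * normSqPS b))).toNNReal,
    fun p hp u => ?_⟩
  rw [ENNReal.coe_toNNReal hfin]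
  have hk : Continuous fun b : PhaseSpace n => D * Real.exp (-ε * normSqPS b) := by
    have := continuous_normSqPS (n := n)
    fun_prop
  exact eLpNorm_le_of_enorm_le_lintegral hk.measurable.ennreal_ofReal
    (continuous_apply_wavePacket hA u).measurable (h u) hp

end Comparison

/-! ### Linear changes of variables in L^p -/

section ChangeOfVariables

variable {X Y : Type} [NormedAddCommGroup X] [NormedSpace ℝ X]
  [MeasurableSpace X] [BorelSpace X] [NormedAddCommGroup Y] [NormedSpace ℝ Y]
  [FiniteDimensional ℝ Y] [MeasurableSpace Y] [BorelSpace Y]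

/-- A linear change of variables is bounded on all `L^p` spaces, uniformly in `p`. -/
theorem exists_eLpNorm_comp_le (e : X ≃L[ℝ] Y) (μ : Measure X) [μ.IsAddHaarMeasure]
    (ν : Measure Y) [ν.IsAddHaarMeasure] :
    ∃ K : ℝ≥0, ∀ (p : ℝ≥0∞), 1 ≤ p → ∀ f : Y → ℂ, Continuous f →
      eLpNorm (fun x => f (e x)) p μ ≤ K * eLpNorm f p ν := by
  have := e.isAddHaarMeasure_map μ
  set c := Measure.addHaarScalarFactor (μ.map e) ν
  have hc : μ.map e = c • ν := Measure.isAddLeftInvariant_eq_smul _ _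
  -- The Jacobian factor is c^{1/p} with 0 ≤ 1/p ≤ 1, so max(1, c) bounds it for all p at once,
  -- including p = ∞.
  refine ⟨max 1 c, fun p hp f hf => ?_⟩
  have h1 : eLpNorm (fun x => f (e x)) p μ = eLpNorm f p (μ.map e) :=
    (eLpNorm_map_measure hf.aestronglyMeasurable e.continuous.aemeasurable).symm
  rw [h1, hc]
  refine (eLpNorm_smul_measure_le (c : ℝ≥0∞) f p ν).trans ?_
  rw [smul_eq_mul]
  gcongr
  have h2 : (1 / p).toReal ≤ 1 := by
    rw [← ENNReal.toReal_one]
    exact ENNReal.toReal_mono ENNReal.one_ne_top (by simpa using hp)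
  calc (c : ℝ≥0∞) ^ (1 / p).toReal ≤ ((max 1 c : ℝ≥0) : ℝ≥0∞) ^ (1 / p).toReal := by
        gcongr
        exact le_max_right _ _
    _ ≤ ((max 1 c : ℝ≥0) : ℝ≥0∞) ^ (1 : ℝ) :=
        ENNReal.rpow_le_rpow_of_exponent_le (by exact_mod_cast le_max_left 1 c) h2
    _ = _ := ENNReal.rpow_one _

end ChangeOfVariables

/-! ### From phases to wave packets: weights, transforms and norms -/

section PhaseGeometry

variable {n : ℕ}

theorem hessYY_isSymm (φ : HolQuadForm n) : (hessYY φ).IsSymm := by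
  ext j k
  exact QuadraticMap.polar_comm _ _ _

theorem inl_eq_sum (x : Fin n → ℂ) : ((x, 0) : (Fin n → ℂ) × (Fin n → ℂ)) =
    ∑ j, x j • ((Pi.single j 1, 0) : (Fin n → ℂ) × (Fin n → ℂ)) := by
  ext i
  · simp [Prod.fst_sum, Finset.sum_apply, Pi.single_apply]
  · simp [Prod.snd_sum]

/-- The complex frequency `φ''_yx x` of the kernel. -/
noncomputable def Phase.freq (φ : Phase n) : (Fin n → ℂ) →ₗ[ℂ] (Fin n → ℂ) :=
  (hessXY φ.form).transpose.mulVecLin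

theorem Phase.freq_apply (φ : Phase n) (x : Fin n → ℂ) (k : Fin n) :
    φ.freq x k = QuadraticMap.polar φ.form (x, 0) (0, Pi.single k 1) := by
  have hp : ∀ v w, QuadraticMap.polar φ.form v w = φ.form.polarBilin v w := fun v w => rfl
  rw [hp, inl_eq_sum, map_sum, LinearMap.sum_apply]
  simp only [Phase.freq, Matrix.mulVecLin_apply, Matrix.mulVec, dotProduct, Matrix.transpose_apply]
  refine Finset.sum_congr rfl fun j _ => ?_
  rw [map_smul, LinearMap.smul_apply, smul_eq_mul, mul_comm]
  rfl

theorem Phase.freq_injective (φ : Phase n) : Function.Injective φ.freq := by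
  have h : IsUnit (hessXY φ.form).transpose := by
    rw [Matrix.isUnit_iff_isUnit_det, Matrix.det_transpose]
    exact φ.det_hessXY_ne_zero.isUnit
  exact Matrix.mulVec_injective_of_isUnit h

/-- The complex frequency of a wave packet centred at `(q, ξ)`. -/
noncomputable def packetFreq (A : Matrix (Fin n) (Fin n) ℂ) :
    PhaseSpace n →ₗ[ℝ] (Fin n → ℂ) where
  toFun a := ofRealVec a.2 - A.mulVec (ofRealVec a.1)
  map_add' a b := by
    simp only [Prod.fst_add, Prod.snd_add, ofRealVec_add, Matrix.mulVec_add]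
    abel
  map_smul' t a := by
    have h : ∀ q : EuclideanSpace ℝ (Fin n), ofRealVec (t • q) = t • ofRealVec q := by
      intro q
      ext j
      simp [ofRealVec]
    simp only [Prod.smul_fst, Prod.smul_snd, h, Matrix.mulVec_smul, smul_sub, RingHom.id_apply]

theorem packetFreq_apply (A : Matrix (Fin n) (Fin n) ℂ) (a : PhaseSpace n) :
    packetFreq A a = ofRealVec a.2 - A.mulVec (ofRealVec a.1) := rfl

/-- If ξ = Aq with q and ξ real, then Aq·q is real, so positivity of Im A forces q = 0 and then ξ =
0. -/
theorem packetFreq_injective {A : Matrix (Fin n) (Fin n) ℂ} (hA : (A.map Complex.im).PosDef) :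
    Function.Injective (packetFreq A) := by
  rw [← LinearMap.ker_eq_bot, LinearMap.ker_eq_bot']
  rintro ⟨q, ξ⟩ h
  rw [packetFreq_apply, sub_eq_zero] at h
  dsimp only at h
  have h1 : (bil A (ofRealVec q) (ofRealVec q)).im = 0 := by
    rw [bil, ← h, ofRealVec_dotProduct_im]
  obtain ⟨c, hc, hc'⟩ := exists_le_bil_im hA
  have hq : q = 0 := by
    have := hc' q
    rw [h1] at this
    have h2 : ‖q‖ ^ 2 = 0 := by
      have := sq_nonneg ‖q‖
      nlinarith
    simpa using h2
  subst hq
  have h0 : ofRealVec (0 : EuclideanSpace ℝ (Fin n)) = 0 := by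
    ext j
    simp [ofRealVec]
  rw [h0, Matrix.mulVec_zero] at h
  have hξ : ξ = 0 := by
    ext j
    simpa [ofRealVec] using congrFun h j
  rw [hξ]
  rfl

theorem finrank_phaseSpace : Module.finrank ℝ (PhaseSpace n) = Module.finrank ℝ (Fin n → ℂ) := by
  simp [Module.finrank_pi_fintype, Complex.finrank_real_complex]
  ring

/-- The identification of `ℂⁿ` with phase space given by a phase. -/
noncomputable def Phase.toPhaseSpace (φ : Phase n) : (Fin n → ℂ) ≃L[ℝ] PhaseSpace n :=
  ((LinearEquiv.ofInjectiveEndo (φ.freq.restrictScalars ℝ) φ.freq_injective).trans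
    (LinearMap.linearEquivOfInjective (packetFreq (hessYY φ.form))
      (packetFreq_injective φ.im_hessYY_posDef) finrank_phaseSpace).symm).toContinuousLinearEquiv

/-- The defining relation ξ = φ''_yx x + φ''_yy q. It says that φ'_y(x, q) is the real vector ξ,
hence that q is the critical point of y ↦ -Im φ(x, y) on ℝⁿ. -/
theorem Phase.packetFreq_toPhaseSpace (φ : Phase n) (x : Fin n → ℂ) :
    packetFreq (hessYY φ.form) (φ.toPhaseSpace x) = φ.freq x :=
  (LinearMap.linearEquivOfInjective (packetFreq (hessYY φ.form))
    (packetFreq_injective φ.im_hessYY_posDef) finrank_phaseSpace).apply_symm_apply (φ.freq x)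

theorem Phase.form_eq_planeExponent (φ : Phase n) (x : Fin n → ℂ)
    (y : EuclideanSpace ℝ (Fin n)) : Complex.I * φ.form (x, ofRealVec y) =
      Complex.I * φ.form (x, 0) + planeExponent (hessYY φ.form) (φ.freq x) y := by
  have h : ∑ k, QuadraticMap.polar φ.form (x, 0) (0, Pi.single k 1) * (y k : ℂ) =
      φ.freq x ⬝ᵥ ofRealVec y :=
    Finset.sum_congr rfl fun k _ => by rw [φ.freq_apply, ofRealVec]
  rw [form_expand, h, planeExponent, bil_eq_sum]
  simp only [ofRealVec]
  ring

theorem Phase.kernel_eq_planeGaussian (φ : Phase n) (x : Fin n → ℂ) :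
    φ.kernel x = Complex.exp (Complex.I * φ.form (x, 0)) •
      planeGaussian φ.im_hessYY_posDef (φ.freq x) := by
  ext y
  change Complex.exp (Complex.I * φ.form (x, ofRealVec y)) = Complex.exp _ * Complex.exp _
  rw [φ.form_eq_planeExponent, Complex.exp_add]

theorem Phase.form_eq_packetPhase (φ : Phase n) (x : Fin n → ℂ) (y : EuclideanSpace ℝ (Fin n)) :
    φ.form (x, ofRealVec y) = φ.form (x, 0) -
      1 / 2 * bil (hessYY φ.form) (ofRealVec (φ.toPhaseSpace x).1)
        (ofRealVec (φ.toPhaseSpace x).1) +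
      packetPhase (hessYY φ.form) (φ.toPhaseSpace x) y := by
  have h := φ.form_eq_planeExponent x y
  rw [← φ.packetFreq_toPhaseSpace, packetFreq_apply] at h
  apply mul_left_cancel₀ Complex.I_ne_zero
  rw [h]
  set a := φ.toPhaseSpace x
  simp only [packetPhase, planeExponent, ofRealVec_sub, bil_sub_left, bil_sub_right,
    sub_dotProduct, mulVec_dotProduct_eq_bil,
    bil_comm (hessYY_isSymm φ.form) (ofRealVec a.1) (ofRealVec y)]
  ring

/-- After completing the square, -Im φ(x, y) is a constant minus half of a positive definite form in
y - q, so the supremum is attained at y = q. -/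
theorem Phase.weight_eq (φ : Phase n) (x : Fin n → ℂ) :
    φ.weight x = -(φ.form (x, 0)).im + 1 / 2 * (bil (hessYY φ.form)
      (ofRealVec (φ.toPhaseSpace x).1) (ofRealVec (φ.toPhaseSpace x).1)).im := by
  set a := φ.toPhaseSpace x with ha
  have h : ∀ y, -(φ.form (x, ofRealVec y)).im = -(φ.form (x, 0)).im +
      1 / 2 * (bil (hessYY φ.form) (ofRealVec a.1) (ofRealVec a.1)).im -
      1 / 2 * (bil (hessYY φ.form) (ofRealVec (y - a.1)) (ofRealVec (y - a.1))).im := by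
    intro y
    have e : (1 / 2 : ℂ) = ((1 / 2 : ℝ) : ℂ) := by simp
    rw [φ.form_eq_packetPhase, packetPhase, e]
    simp only [Complex.add_im, Complex.sub_im, Complex.im_ofReal_mul, ofRealVec_dotProduct_im]
    ring
  apply le_antisymm
  · refine ciSup_le fun y => ?_
    rw [h y]
    linarith [bil_im_nonneg φ.im_hessYY_posDef (y - a.1)]
  · refine le_trans (le_of_eq ?_) (le_ciSup (φ.weight_bddAbove x) a.1)
    have h0 : ofRealVec (0 : EuclideanSpace ℝ (Fin n)) = 0 := by
      ext j
      simp [ofRealVec]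
    rw [h a.1, sub_self, h0]
    simp [bil]

theorem Phase.differentiable_form (φ : Phase n) :
    Differentiable ℂ fun x : Fin n → ℂ => φ.form (x, 0) := by
  have h : (fun x : Fin n → ℂ => φ.form (x, 0)) = fun x => 1 / 2 *
      ∑ j, φ.form.polarBilin (x, 0) (Pi.single j 1, 0) * x j := by
    funext x
    have h1 := QuadraticMap.polar_self φ.form ((x, 0) : (Fin n → ℂ) × (Fin n → ℂ))
    have h2 : ∀ v, φ.form.polarBilin v (x, 0) =
        ∑ j, φ.form.polarBilin v (Pi.single j 1, 0) * x j := by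
      intro v
      rw [inl_eq_sum, map_sum]
      refine Finset.sum_congr rfl fun j _ => ?_
      rw [map_smul, smul_eq_mul, mul_comm]
    have h3 : QuadraticMap.polar φ.form (x, 0) (x, 0) =
        ∑ j, φ.form.polarBilin (x, 0) (Pi.single j 1, 0) * x j := h2 (x, 0)
    rw [← h3, h1, nsmul_eq_mul]
    push_cast
    ring
  have h4 : ∀ j, Differentiable ℂ fun x : Fin n → ℂ =>
      φ.form.polarBilin (x, 0) (Pi.single j 1, 0) := fun j =>
    (LinearMap.toContinuousLinearMap ((φ.form.polarBilin.flip (Pi.single j 1, 0)).comp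
      (LinearMap.inl ℂ (Fin n → ℂ) (Fin n → ℂ)))).differentiable
  rw [h]
  fun_prop

theorem Phase.continuous_weight (φ : Phase n) : Continuous φ.weight := by
  have h1 := φ.differentiable_form.continuous
  have h2 := φ.toPhaseSpace.continuous
  have h3 := continuous_ofRealVec (n := n)
  have h : φ.weight = fun x => -(φ.form (x, 0)).im + 1 / 2 * (bil (hessYY φ.form)
      (ofRealVec (φ.toPhaseSpace x).1) (ofRealVec (φ.toPhaseSpace x).1)).im :=
    funext φ.weight_eq
  rw [h]
  have h4 : Continuous fun x => bil (hessYY φ.form)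
      (ofRealVec (φ.toPhaseSpace x).1) (ofRealVec (φ.toPhaseSpace x).1) := by
    unfold bil
    fun_prop
  exact (Complex.continuous_im.comp h1).neg.add
    (continuous_const.mul (Complex.continuous_im.comp h4))

theorem Phase.differentiable_transform (φ : Phase n) (C : ℝ)
    (u : 𝓢'(EuclideanSpace ℝ (Fin n), ℂ)) : Differentiable ℂ (φ.transform C u) := by
  have h1 := differentiable_apply_planeGaussian (hessYY_isSymm φ.form) φ.im_hessYY_posDef u
  have h2 : Differentiable ℂ φ.freq := (LinearMap.toContinuousLinearMap φ.freq).differentiable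
  have h3 : φ.transform C u = fun x => C * (Complex.exp (Complex.I * φ.form (x, 0)) *
      u (planeGaussian φ.im_hessYY_posDef (φ.freq x))) := by
    funext x
    rw [Phase.transform, φ.kernel_eq_planeGaussian]
    exact congrArg _ (map_smul u _ _)
  rw [h3]
  exact ((φ.differentiable_form.const_mul _).cexp.mul (h1.comp h2)).const_mul _

/-- The factor between the kernel and the wave packet has modulus exactly e^{Φ(x)}, because
completing the square and maximising over y give the same constant. The weight therefore disappears.
-/
theorem Phase.norm_weighted_transform (φ : Phase n) (C : ℝ)
    (u : 𝓢'(EuclideanSpace ℝ (Fin n), ℂ)) (x : Fin n → ℂ) :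
    ‖(Real.exp (-φ.weight x) : ℂ) * φ.transform C u x‖ =
      ‖(C : ℂ) * u (wavePacket φ.im_hessYY_posDef (φ.toPhaseSpace x))‖ := by
  set a := φ.toPhaseSpace x with ha
  set d := Complex.I * (φ.form (x, 0) -
    1 / 2 * bil (hessYY φ.form) (ofRealVec a.1) (ofRealVec a.1)) with hd
  have h1 : φ.kernel x = Complex.exp d • wavePacket φ.im_hessYY_posDef a := by
    ext y
    change Complex.exp (Complex.I * φ.form (x, ofRealVec y)) = Complex.exp d * _
    rw [wavePacket_apply, ← Complex.exp_add, φ.form_eq_packetPhase, hd, mul_add]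
  have h2 : d.re = φ.weight x := by
    have e : (1 / 2 : ℂ) = ((1 / 2 : ℝ) : ℂ) := by simp
    rw [φ.weight_eq, ← ha, hd, Complex.I_mul_re, Complex.sub_im, e, Complex.im_ofReal_mul]
    ring
  have h3 : u (φ.kernel x) = Complex.exp d * u (wavePacket φ.im_hessYY_posDef a) := by
    rw [h1]
    exact map_smul u _ _
  rw [Phase.transform, h3, norm_mul, norm_mul, norm_mul, norm_mul, Complex.norm_exp, h2,
    Complex.norm_real, Real.norm_of_nonneg (Real.exp_pos _).le, mul_left_comm, ← mul_assoc (Real.exp _),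
    ← Real.exp_add, neg_add_cancel, Real.exp_zero, one_mul]

theorem Phase.weightedNorm_transform (φ : Phase n) {C : ℝ} (hC : 0 < C) (p : ℝ≥0∞)
    (u : 𝓢'(EuclideanSpace ℝ (Fin n), ℂ)) :
    weightedNorm φ.weight p (φ.transform C u) = ENNReal.ofReal C *
      eLpNorm (fun x => u (wavePacket φ.im_hessYY_posDef (φ.toPhaseSpace x))) p volume := by
  rw [weightedNorm, eLpNorm_congr_norm_ae (Filter.Eventually.of_forall
    (φ.norm_weighted_transform C u))]
  refine (eLpNorm_const_smul (C : ℂ) _ p volume).trans ?_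
  rw [← ofReal_norm, Complex.norm_real, Real.norm_of_nonneg hC.le]

/-- The weighted norms of two transforms of a distribution are comparable. -/
theorem Phase.exists_weightedNorm_le (φ ψ : Phase n) {C D : ℝ} (hC : 0 < C) (hD : 0 < D) :
    ∃ K : ℝ≥0, 0 < K ∧ ∀ p : ℝ≥0∞, 1 ≤ p → ∀ u : 𝓢'(EuclideanSpace ℝ (Fin n), ℂ),
      weightedNorm ψ.weight p (ψ.transform D u) ≤
        K * weightedNorm φ.weight p (φ.transform C u) := by
  obtain ⟨K₁, h1⟩ := exists_eLpNorm_comp_le ψ.toPhaseSpace volume volume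
  obtain ⟨K₂, h2⟩ := exists_eLpNorm_apply_wavePacket_le φ.im_hessYY_posDef
    (hessYY_isSymm ψ.form) ψ.im_hessYY_posDef
  obtain ⟨K₃, h3⟩ := exists_eLpNorm_comp_le φ.toPhaseSpace.symm volume volume
  -- K₁ and K₃ come from passing between ℂⁿ and phase space, K₂ from the change of Gaussian, D and
  -- C⁻¹ from the normalisations. Adding 1 ensures positivity.
  refine ⟨D.toNNReal * K₁ * K₂ * K₃ * C.toNNReal⁻¹ + 1, by positivity, fun p hp u => ?_⟩
  rw [φ.weightedNorm_transform hC, ψ.weightedNorm_transform hD]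
  have hφ := continuous_apply_wavePacket φ.im_hessYY_posDef u
  have h4 := h3 p hp (fun x => u (wavePacket φ.im_hessYY_posDef (φ.toPhaseSpace x)))
    (hφ.comp φ.toPhaseSpace.continuous)
  simp only [ContinuousLinearEquiv.apply_symm_apply] at h4
  set N := eLpNorm (fun x => u (wavePacket φ.im_hessYY_posDef (φ.toPhaseSpace x))) p volume
  have hCC : ((C.toNNReal⁻¹ : ℝ≥0) : ℝ≥0∞) * ENNReal.ofReal C = 1 := by
    have : C.toNNReal ≠ 0 := (Real.toNNReal_pos.2 hC).ne'
    rw [ENNReal.ofReal, ← ENNReal.coe_mul, inv_mul_cancel₀ this, ENNReal.coe_one]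
  calc ENNReal.ofReal D * eLpNorm (fun x => u (wavePacket ψ.im_hessYY_posDef
        (ψ.toPhaseSpace x))) p volume
      ≤ ENNReal.ofReal D * (K₁ * (K₂ * (K₃ * N))) := by
        gcongr
        refine (h1 p hp _ (continuous_apply_wavePacket ψ.im_hessYY_posDef u)).trans ?_
        gcongr
        refine (h2 p hp u).trans ?_
        gcongr
    _ = ((D.toNNReal * K₁ * K₂ * K₃ * C.toNNReal⁻¹ : ℝ≥0) : ℝ≥0∞) * (ENNReal.ofReal C * N) := by
        push_cast
        calc ENNReal.ofReal D * (K₁ * (K₂ * (K₃ * N)))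
            = ENNReal.ofReal D * K₁ * K₂ * K₃ * (1 * N) := by ring
          _ = _ := by
            rw [← hCC]
            simp only [ENNReal.ofReal]
            ring
    _ ≤ _ := by
        gcongr
        exact le_self_add

/-- The transform of a tempered distribution is always entire and the weight is continuous, so
holomorphy and measurability come for free. -/
theorem Phase.transform_mem_weightedSpace (φ : Phase n) {C : ℝ} {p : ℝ≥0∞}
    {u : 𝓢'(EuclideanSpace ℝ (Fin n), ℂ)} : φ.transform C u ∈ weightedSpace φ.weight p ↔
      weightedNorm φ.weight p (φ.transform C u) < ⊤ := by
  refine ⟨fun h => h.2.2, fun h => ⟨φ.differentiable_transform C u, ?_, h⟩⟩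
  have h1 := φ.continuous_weight
  have h2 := (φ.differentiable_transform C u).continuous
  exact Continuous.aestronglyMeasurable (by fun_prop)

theorem Phase.transform_mem_of_mem (φ ψ : Phase n) {C D : ℝ} (hC : 0 < C) (hD : 0 < D)
    {p : ℝ≥0∞} (hp : 1 ≤ p) {u : 𝓢'(EuclideanSpace ℝ (Fin n), ℂ)}
    (h : φ.transform C u ∈ weightedSpace φ.weight p) :
    ψ.transform D u ∈ weightedSpace ψ.weight p := by
  obtain ⟨K, -, hK⟩ := φ.exists_weightedNorm_le ψ hC hD
  rw [Phase.transform_mem_weightedSpace] at h ⊢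
  exact (hK p hp u).trans_lt (ENNReal.mul_lt_top ENNReal.coe_lt_top h)

end PhaseGeometry
end FBI

theorem propositionA1 (n : ℕ) (φ ψ : FBI.Phase n) (C D : ℝ) (hC : 0 < C) (hD : 0 < D) :
    (∀ p : ℝ≥0∞, 1 ≤ p → ∀ u : 𝓢'(EuclideanSpace ℝ (Fin n), ℂ),
      (φ.transform C u ∈ FBI.weightedSpace φ.weight p ↔
        ψ.transform D u ∈ FBI.weightedSpace ψ.weight p)) ∧
    (∃ K : ℝ≥0, 0 < K ∧ ∀ p : ℝ≥0∞, 1 ≤ p → ∀ u : 𝓢'(EuclideanSpace ℝ (Fin n), ℂ),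
      FBI.weightedNorm ψ.weight p (ψ.transform D u) ≤
          K * FBI.weightedNorm φ.weight p (φ.transform C u) ∧
        FBI.weightedNorm φ.weight p (φ.transform C u) ≤
          K * FBI.weightedNorm ψ.weight p (ψ.transform D u)) ∧
    (∀ p : ℝ≥0∞, 1 ≤ p → φ.modulationSpace C p = ψ.modulationSpace D p) := by
  have hmem : ∀ p : ℝ≥0∞, 1 ≤ p → ∀ u : 𝓢'(EuclideanSpace ℝ (Fin n), ℂ),
      (φ.transform C u ∈ FBI.weightedSpace φ.weight p ↔
        ψ.transform D u ∈ FBI.weightedSpace ψ.weight p) := fun p hp u =>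
    ⟨φ.transform_mem_of_mem ψ hC hD hp, ψ.transform_mem_of_mem φ hD hC hp⟩
  obtain ⟨K₁, hK₁, h1⟩ := φ.exists_weightedNorm_le ψ hC hD
  obtain ⟨K₂, -, h2⟩ := ψ.exists_weightedNorm_le φ hD hC
  refine ⟨hmem, ⟨max K₁ K₂, lt_max_of_lt_left hK₁, fun p hp u => ⟨?_, ?_⟩⟩,
    fun p hp => Set.ext (hmem p hp)⟩
  · exact (h1 p hp u).trans (by gcongr; exact le_max_left _ _)
  · exact (h2 p hp u).trans (by gcongr; exact le_max_right _ _)
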